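/- **Setting.** Let $K$ be a field, $\mathbb F\subset K$ a subfield, and $F_0=\mathrm{Id},F_1,\dots,F_n:K\to K$ $\mathbb F$-linear operators such that $F_k(xy)=\sum_{i,j}a_{i,j}^kF_i(x)F_j(y)$ for $0\le k\le n$, where the $a_{i,j}^k\in\mathbb F$ are the structure constants, in a basis $e_0,\dots,e_n$, of a commutative (unital) $\mathbb F$-algebra $\mathcal D$, and such that $\varphi(x)=\sum_kF_k(x)e_k$ is a morphism of $\mathbb F$-algebras $K\to K\otimes_{\mathbb F}\mathcal D$ (so $\varphi(1)=1$). Assume that all residue fields of $\mathcal D$ are equal to $\mathbb F$, and that for every residual projection $\rho:\mathcal D\to\mathbb F$ (a morphism of $\mathbb F$-algebras) the associated endomorphism $\sigma_\rho=\sum_k\rho(e_k)F_k$ of $K$ is bijective. Let $\mathcal L$ be the language of rings with constants for the elements of $\mathbb F$ and unary function symbols for $F_1,\dots,F_n$ and all $\sigma_\rho^{-1}$; regard $K$ as an $\mathcal L$-structure. Assume that $K$ is separably closed, and $\kappa$-saturated and strongly $\kappa$-homogeneous for a cardinal $\kappa>\aleph_0+|\mathbb F|$; a set is *small* if its cardinality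 is less than $\kappa$. For $A\subset K$ let $\langle A\rangle$ be the fraction field in $K$ of the $\mathcal L$-substructure generated by $A$, and $\langle A\rangle^{alg}$ its field-theoretic algebraic closure inside a fixed algebraic closure of $K$. Write $a\equiv_A b$ if the tuples $a$ and $b$ have the same type over $A$. Say that $A$ is *independent* of $B$ over $C$, written $A\perp_C B$, if $\langle A\cup C\rangle^{alg}$ and $\langle B\cup C\rangle^{alg}$ are linearly disjoint over $\langle C\rangle^{alg}$. Assume further: 1. The model-theoretic algebraic closure of every $A\subset K$ is $\langle A\rangle^{alg}\cap K$; and two finite tuples $a,b$ have the same type over a subfield $k=\langle k\rangle$ if and only if there is an $\mathcal L$-isomorphism $\langle k\cup a\rangle^{alg}\cap K\to\langle k\cup b\rangle^{alg}\cap K$ fixing $k$ and sending $a$ to $b$. 2. (Extension) For every finite tuple $a$ and small sets $C\subset B$ there is $a'\equiv_Ca$ with $a'\perp_CB$. (Independence theorem) If $k=\langle k\rangle^{alg}\cap K$, $C$ and $D$ are small sets containing $k$ with $C\perp_kD$, and $a\equiv_kb$ are finite tuples with $a\perp_kC$ and $b\perp_kD$, then there is $c\perp_kC\cup D$ with $c\equiv_Ca$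 and $c\equiv_Db$. 3. If $B=\langle B\rangle^{alg}\cap K$ is small, $a$ is a finite tuple and $(a_i)_{i<\omega}$ is a Morley sequence of $\mathrm{tp}(a/B)$ (a $B$-indiscernible sequence of realizations with $a_i\perp_B\{a_j:j<i\}$ for all $i$), then $a\perp_XB$ for $X=B\cap\langle\{a_i\}_{i<\omega}\rangle^{alg}$. An element $g\in K$ is *generic* over $A$ if for all $h\in K$ with $g\perp_Ah$ one has $h+g\perp_\emptyset A\cup\{h\}$. Fix a generic type $p$ over $\emptyset$, i.e. the type over $\emptyset$ of an element generic over $\emptyset$. For $D\subset K$ let $\mathrm{cl}(D)$ be the set of $x\in K$ such that $a\perp_{D_1}x$ for every small $D_1\supset D$ and every realization $a$ of $p$ that is generic over $D_1$. An automorphism $\tau$ of the $\mathcal L$-structure $K$ is *bounded over* a finite set $D$ if $\tau(a)\in\mathrm{cl}(D\cup\{a\})$ for every $a$ generic over $D$. **Statement.** Let $\tau$ be an automorphism of the $\mathcal L$-structure $K$ that is bounded over a finite set $D\subset K$, and let $a,b\in K$ be generic over $D$ with $a\perp_Db$. Put $$D_0=\mathrm{cl}(D)\cap\langle D\cup\{a,b,\tau(a),\tau(b)\}\rangle^{alg}.$$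 Then the pairs $(a,\tau(a))$, $(b,\tau(b))$ and $(ab,\tau(ab))$ are pairwise independent over $D_0$; likewise, the pairs $(a,\tau(a))$, $(b,\tau(b))$ and $(a+b,\tau(a+b))$ are pairwise independent over $D_0$. -/

import Mathlib

open FirstOrder Cardinal

universe u v

/-- Additive operators `F 0 = id, F 1, …, F n` on the field `K`, linear over the base subfield `𝔽`,
whose product rule is given by the structure constants of a commutative `𝔽`-algebra `𝒟` in the
`𝔽`-basis `e 0, …, e n`.  The map `φ x = ∑ k, F k x • e k` from `K` to `K ⊗ 𝒟` is then a morphism of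
`𝔽`-algebras; `map_one` says that it is unital. -/
structure FieldOperators {K : Type u} [Field K] (𝔽 : Subfield K) {n : ℕ} {𝒟 : Type v}
    [CommRing 𝒟] [Algebra 𝔽 𝒟] (e : Module.Basis (Fin (n + 1)) 𝔽 𝒟) where
  F : Fin (n + 1) → K →ₗ[𝔽] K
  F_zero : F 0 = LinearMap.id
  map_mul : ∀ (k : Fin (n + 1)) (x y : K),
    F k (x * y) = ∑ i, ∑ j, e.repr (e i * e j) k • (F i x * F j y)
  map_one : ∀ k : Fin (n + 1), F k 1 = algebraMap 𝔽 K (e.repr 1 k)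

/-- Function symbols: those of rings, constants for the base field, the operators `F 1, …, F n`, and
the inverses of the associated endomorphisms. -/
inductive OpFunctions {K : Type u} [Field K] (𝔽 : Subfield K) (n : ℕ) (𝒟 : Type v)
    [CommRing 𝒟] [Algebra 𝔽 𝒟] : ℕ → Type (max u v)
  | zero : OpFunctions 𝔽 n 𝒟 0
  | one : OpFunctions 𝔽 n 𝒟 0
  | const (c : 𝔽) : OpFunctions 𝔽 n 𝒟 0
  | neg : OpFunctions 𝔽 n 𝒟 1
  | add : OpFunctions 𝔽 n 𝒟 2
  | mul : OpFunctions 𝔽 n 𝒟 2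
  | op (i : Fin n) : OpFunctions 𝔽 n 𝒟 1
  | sigmaInv (ρ : 𝒟 →ₐ[𝔽] 𝔽) : OpFunctions 𝔽 n 𝒟 1

namespace FieldOperators

variable {K : Type u} [Field K] {𝔽 : Subfield K} {n : ℕ} {𝒟 : Type v}
  [CommRing 𝒟] [Algebra 𝔽 𝒟] {e : Module.Basis (Fin (n + 1)) 𝔽 𝒟}

/-- Every residue field of the finite-dimensional algebra `𝒟` (equivalently, of one of its local
factors) is `𝔽`. -/
def ResidueFieldsEqBase (_O : FieldOperators 𝔽 e) : Prop :=
  ∀ m : Ideal 𝒟, m.IsMaximal → Function.Bijective (algebraMap 𝔽 (𝒟 ⧸ m))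

/-- The endomorphism `σ` of `K` associated with a local factor of `𝒟` with residue field `𝔽`.  Such a
factor is given by its residual projection `ρ : 𝒟 → 𝔽`, and `σ` is the composition of `φ` with the
extension of `ρ` to `K ⊗ 𝒟`. -/
noncomputable def sigma (O : FieldOperators 𝔽 e) (ρ : 𝒟 →ₐ[𝔽] 𝔽) (x : K) : K :=
  ∑ k, ρ (e k) • O.F k x

/-- The associated endomorphisms are automorphisms of the field `K`. -/
def AssociatedBijective (O : FieldOperators 𝔽 e) : Prop :=
  ∀ ρ : 𝒟 →ₐ[𝔽] 𝔽, Function.Bijective (O.sigma ρ)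

/-- The language of rings with constants for `𝔽` and unary symbols for the operators and for the
inverses of the associated automorphisms. -/
def lang (_O : FieldOperators 𝔽 e) : FirstOrder.Language.{max u v, 0} :=
  ⟨OpFunctions 𝔽 n 𝒟, fun _ => Empty⟩

noncomputable instance instStructure (O : FieldOperators 𝔽 e) : O.lang.Structure K where
  funMap {_} f x := match f, x with
    | .zero, _ => 0
    | .one, _ => 1
    | .const c, _ => (c : K)
    | .neg, x => - x 0
    | .add, x => x 0 + x 1
    | .mul, x => x 0 * x 1
    | .op i, x => O.F i.succ (x 0)
    | .sigmaInv ρ, x => Function.invFun (O.sigma ρ) (x 0)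
  RelMap {_} r _ := r.elim

/-- The fraction field in `K` of the substructure generated by `A`. -/
def gen (O : FieldOperators 𝔽 e) (A : Set K) : Subfield K :=
  Subfield.closure (FirstOrder.Language.Substructure.closure O.lang A : Set K)

/-- The field-theoretic algebraic closure of `O.gen A`, inside an algebraic closure of `K`. -/
noncomputable def alg (O : FieldOperators 𝔽 e) (A : Set K) : Subfield (AlgebraicClosure K) :=
  (algebraicClosure (O.gen A) (AlgebraicClosure K)).toSubfield

/-- The elements of `K` that are algebraic, as field elements, over `O.gen A`. -/
def algIn (O : FieldOperators 𝔽 e) (A : Set K) : Set K :=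
  algebraMap K (AlgebraicClosure K) ⁻¹' (O.alg A : Set (AlgebraicClosure K))

theorem gen_mono (O : FieldOperators 𝔽 e) {A B : Set K} (h : A ⊆ B) : O.gen A ≤ O.gen B :=
  Subfield.closure_mono ((FirstOrder.Language.Substructure.closure O.lang).monotone h)

theorem algebraicClosure_mono {Ω : Type*} [Field Ω] [Algebra K Ω] {k l : Subfield K} (h : k ≤ l) :
    (algebraicClosure k Ω).toSubfield ≤ (algebraicClosure l Ω).toSubfield := by
  intro x hx
  have hx' : x ∈ algebraicClosure k Ω := hx
  obtain ⟨p, hp, hpx⟩ := mem_algebraicClosure_iff.1 hx'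
  have key : x ∈ algebraicClosure l Ω := by
    refine mem_algebraicClosure_iff.2 ⟨p.map (Subfield.inclusion h), ?_, ?_⟩
    · exact (Polynomial.map_ne_zero_iff (Subfield.inclusion h).injective).2 hp
    · rw [Polynomial.aeval_def, Polynomial.eval₂_map]
      exact hpx
  exact key

theorem alg_mono (O : FieldOperators 𝔽 e) {A B : Set K} (h : A ⊆ B) : O.alg A ≤ O.alg B :=
  algebraicClosure_mono (O.gen_mono h)

/-- `A` is independent of `B` over `C`: the algebraic closures of the fields generated by `A ∪ C` and
by `B ∪ C` are linearly disjoint over the algebraic closure of the field generated by `C`. -/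
def Indep (O : FieldOperators 𝔽 e) (A C B : Set K) : Prop :=
  (Subfield.extendScalars (O.alg_mono (Set.subset_union_right : C ⊆ A ∪ C))).LinearDisjoint
    (Subfield.extendScalars (O.alg_mono (Set.subset_union_right : C ⊆ B ∪ C)))

/-- The tuples `a` and `b` have the same complete type over `A`. -/
def SameType (O : FieldOperators 𝔽 e) (A : Set K) {ι : Type*} (a b : ι → K) : Prop :=
  ∀ φ : (O.lang[[A]]).Formula ι, φ.Realize a ↔ φ.Realize b

/-- Model-theoretic algebraic closure. -/
def acl (O : FieldOperators 𝔽 e) (A : Set K) : Set K :=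
  {x | ∃ S : Set K, A.Definable₁ O.lang S ∧ S.Finite ∧ x ∈ S}

/-- `κ`-saturation. -/
def Saturated (O : FieldOperators 𝔽 e) (κ : Cardinal.{u}) : Prop :=
  ∀ A : Set K, #A < κ → ∀ p : Set ((O.lang[[A]]).Formula (Fin 1)),
    (∀ q : Set ((O.lang[[A]]).Formula (Fin 1)), q ⊆ p → q.Finite →
      ∃ x : K, ∀ φ ∈ q, φ.Realize (fun _ => x)) →
    ∃ x : K, ∀ φ ∈ p, φ.Realize (fun _ => x)

/-- Strong `κ`-homogeneity: an elementary map between subsets of size less than `κ` extends to an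
automorphism. -/
def StronglyHomogeneous (O : FieldOperators 𝔽 e) (κ : Cardinal.{u}) : Prop :=
  ∀ (ι : Type u) (a b : ι → K), #ι < κ → O.SameType ∅ a b →
    ∃ f : K ≃[O.lang] K, ∀ i, f (a i) = b i

/-- The field `K` is separably closed, and is saturated and homogeneous with respect to a cardinal
`κ` greater than the number of formulas of the language. -/
structure SufficientlySaturated (O : FieldOperators 𝔽 e) (κ : Cardinal.{u}) : Prop where
  sepClosed : IsSepClosed K
  aleph0_lt : ℵ₀ < κ
  base_lt : #𝔽 < κ
  saturated : O.Saturated κ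
  homogeneous : O.StronglyHomogeneous κ

/-- Model-theoretic algebraic closure is the field-theoretic one, and the type of a tuple `a` over
a subfield `k` with `k = O.gen k` is given by the isomorphism type of the algebraic closure in `K` of
the structure generated by `k` and `a`. -/
structure TypesDetermined (O : FieldOperators 𝔽 e) : Prop where
  acl_eq : ∀ A : Set K, O.acl A = O.algIn A
  sameType_iff : ∀ (k : Set K), k = O.gen k → ∀ (m : ℕ) (a b : Fin m → K),
    O.SameType k a b ↔
      ∃ (S T : O.lang.Substructure K), (S : Set K) = O.algIn (k ∪ Set.range a) ∧
        (T : Set K) = O.algIn (k ∪ Set.range b) ∧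
        ∃ f : S ≃[O.lang] T, (∀ x : S, (x : K) ∈ k → (f x : K) = x) ∧
          ∀ (i : Fin m) (x : S), (x : K) = a i → (f x : K) = b i

/-- Independence satisfies extension, and amalgamation of types over algebraically closed subfields
(the independence theorem).  As usual, parameter sets have size less than `κ`. -/
structure IndepSimple (O : FieldOperators 𝔽 e) (κ : Cardinal.{u}) : Prop where
  extension : ∀ (m : ℕ) (a : Fin m → K) (C B : Set K), C ⊆ B → #B < κ →
    ∃ a' : Fin m → K, O.SameType C a' a ∧ O.Indep (Set.range a') C B
  amalgamation : ∀ (k : Set K), k = O.algIn k → ∀ (m : ℕ) (a b : Fin m → K), O.SameType k a b →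
    ∀ C D : Set K, k ⊆ C → k ⊆ D → #C < κ → #D < κ → O.Indep C k D →
      O.Indep (Set.range a) k C → O.Indep (Set.range b) k D →
      ∃ c : Fin m → K, O.Indep (Set.range c) k (C ∪ D) ∧ O.SameType C c a ∧ O.SameType D c b

/-- `s` is a Morley sequence of `tp(a / B)`: a sequence of realizations of this type, independent
and indiscernible over `B`. -/
structure IsMorleySequence (O : FieldOperators 𝔽 e) (B : Set K) {m : ℕ} (a : Fin m → K)
    (s : ℕ → Fin m → K) : Prop where
  realizes : ∀ i, O.SameType B (s i) a
  indep : ∀ i, O.Indep (Set.range (s i)) B (⋃ j < i, Set.range (s j))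
  indiscernible : ∀ (r : ℕ) (t : Fin r → ℕ), StrictMono t →
    O.SameType B (fun q : Fin r × Fin m => s q.1 q.2) (fun q => s (t q.1) q.2)

/-- Every tuple `a` is independent of an algebraically closed `B` over the elements of `B` that are
algebraic over a Morley sequence of `tp(a / B)`. -/
def MorleyBase (O : FieldOperators 𝔽 e) (κ : Cardinal.{u}) : Prop :=
  ∀ (B : Set K), B = O.algIn B → #B < κ → ∀ (m : ℕ) (a : Fin m → K) (s : ℕ → Fin m → K),
    O.IsMorleySequence B a s →
      O.Indep (Set.range a) (B ∩ O.algIn (⋃ i, Set.range (s i))) B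

/-- `g` is generic over `A` in the additive group of `K`. -/
def Generic (O : FieldOperators 𝔽 e) (g : K) (A : Set K) : Prop :=
  ∀ h : K, O.Indep {g} A {h} → O.Indep {h + g} ∅ (A ∪ {h})

/-- The closure `cl_p(D)` with respect to the type `p` of `g` over the empty set: the elements that are
co-foreign to `p` over `D`.  Parameter sets have size less than `κ`. -/
def cl (O : FieldOperators 𝔽 e) (κ : Cardinal.{u}) (g : K) (D : Set K) : Set K :=
  {x | ∀ D₁ : Set K, D ⊆ D₁ → #D₁ < κ → ∀ a : K, O.SameType ∅ (fun _ : Fin 1 => a) (fun _ => g) →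
    O.Generic a D₁ → O.Indep {a} D₁ {x}}

/-- The automorphism `τ` is bounded over the set `D`. -/
def BoundedOver (O : FieldOperators 𝔽 e) (κ : Cardinal.{u}) (g : K) (τ : K ≃[O.lang] K)
    (D : Set K) : Prop :=
  ∀ a : K, O.Generic a D → τ a ∈ O.cl κ g (D ∪ {a})

/-- Three sets are pairwise independent over `C`. -/
def PairwiseIndep (O : FieldOperators 𝔽 e) (C X Y Z : Set K) : Prop :=
  O.Indep X C Y ∧ O.Indep X C Z ∧ O.Indep Y C Z

end FieldOperators

/-! ### Linear disjointness and algebraic independence over an algebraically closed field. -/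

section TensorDomain

open TensorProduct

/-! Let E be the set of elements of K algebraic over D₀, a and τ(a). Boundedness places E inside
cl(D ∪ {a}), and b is generic and independent of a over D, so b is independent of E. Take a Morley
sequence of tp(b, τ(b) / E). The Morley hypothesis makes (b, τ(b)) independent of E over X, the set
of elements of E algebraic over the sequence, so everything reduces to X ⊆ D₀. An x in X is
algebraic over finitely many pairs of the sequence; by boundedness it lies in the closure of D
together with their first coordinates. Those coordinates are jointly independent of E, which
contains x, and `mem_cl_of_indep` then allows them to be dropped: x ∈ cl(D). This is
`indep_pair_of_boundedOver`.

Let c be ab or a + b. It is again generic and independent of a and of b separately, and each of the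
three pairs is algebraic over the other two. Hence D₀ is the same set whichever two of a, b, c
define it, and the two-pair statement applies three times. For the product, additive genericity has
to survive multiplication by an independent nonzero element (`Generic.mul`).

Three supports carry this. Linear disjointness over an algebraically closed field amounts to
preservation of algebraic independence, which yields the calculus of independence
(`Indep.base_mono`, `Indep.trans`, finite character). The closure cl can be tested on all generics
instead of realizations of p (`mem_cl_iff`). Morley sequences exist, as iterated ultrafilter
averages of an independent sequence (`exists_isMorleySequence`). -/

theorem exists_algHom_apply_ne_zero {k A : Type*} [Field k] [IsAlgClosed k] [CommRing A]
    [IsDomain A] [Algebra k A] [Algebra.FiniteType k A] {s : A} (hs : s ≠ 0) :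
    ∃ χ : A →ₐ[k] k, χ s ≠ 0 := by
  -- Nullstellensatz: a residue field of the localization at `s` is finite over `k`, hence equal to
  -- `k`, and `s` is a unit there.
  have hft : Algebra.FiniteType A (Localization.Away s) :=
    IsLocalization.finiteType_of_monoid_fg (Submonoid.powers s) _
  have : Algebra.FiniteType k (Localization.Away s) := Algebra.FiniteType.trans ‹_› hft
  have : Nontrivial (Localization.Away s) :=
    (IsLocalization.injective (Localization.Away s)
      (powers_le_nonZeroDivisors_of_noZeroDivisors hs)).nontrivial
  obtain ⟨m, hm⟩ := Ideal.exists_maximal (Localization.Away s)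
  let := Ideal.Quotient.field m
  have := finite_of_finite_type_of_isJacobsonRing k (Localization.Away s ⧸ m)
  let φ : k ≃ₐ[k] (Localization.Away s ⧸ m) := AlgEquiv.ofBijective (Algebra.ofId _ _)
    IsAlgClosed.algebraMap_bijective_of_isIntegral
  refine ⟨(φ.symm.toAlgHom.comp (Ideal.Quotient.mkₐ k m)).comp
    (IsScalarTower.toAlgHom k A (Localization.Away s)), ?_⟩
  have hu : IsUnit (algebraMap A (Localization.Away s) s) :=
    IsLocalization.Away.algebraMap_isUnit s
  exact ((hu.map (Ideal.Quotient.mkₐ k m)).map φ.symm).ne_zero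

/-- Write both factors in a `k`-basis of `B`, with coordinates in `A`. If neither is zero, some
`k`-point of `A` keeps one coordinate of each nonzero; specializing there gives two nonzero elements
of the domain `B` with product zero. -/
theorem tensorProduct_noZeroDivisors_of_finiteType {k A B : Type*} [Field k] [IsAlgClosed k]
    [CommRing A] [IsDomain A] [Algebra k A] [Algebra.FiniteType k A] [CommRing B] [IsDomain B]
    [Algebra k B] (x y : A ⊗[k] B) (h : x * y = 0) : x = 0 ∨ y = 0 := by
  by_contra! hxy
  let b := Module.Basis.ofVectorSpace k B
  have key : ∀ (χ : A →ₐ[k] k) (z : A ⊗[k] B) i,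
      b.repr (Algebra.TensorProduct.lift ((Algebra.ofId k B).comp χ) (AlgHom.id k B)
        (fun _ _ => Commute.all _ _) z) i = χ ((Algebra.TensorProduct.basis A b).repr z i) := by
    intro χ z i
    induction z with
    | zero => simp
    | add u v hu hv => simp only [map_add, Finsupp.add_apply, hu, hv]
    | tmul a m =>
      simp [Algebra.TensorProduct.basis_repr_tmul, Algebra.ofId_apply, ← Algebra.smul_def]
  have hne : ∀ z : A ⊗[k] B, z ≠ 0 → ∃ i, (Algebra.TensorProduct.basis A b).repr z i ≠ 0 := by
    intro z hz
    by_contra! h0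
    exact hz ((Algebra.TensorProduct.basis A b).repr.map_eq_zero_iff.1 (Finsupp.ext h0))
  obtain ⟨i, hi⟩ := hne x hxy.1
  obtain ⟨j, hj⟩ := hne y hxy.2
  obtain ⟨χ, hχ⟩ := exists_algHom_apply_ne_zero (k := k) (mul_ne_zero hi hj)
  rw [map_mul] at hχ
  have h0 := congrArg (Algebra.TensorProduct.lift ((Algebra.ofId k B).comp χ) (AlgHom.id k B)
        (fun _ _ => Commute.all _ _)) h
  rw [map_mul, map_zero, mul_eq_zero] at h0
  rcases h0 with h0 | h0
  · have := key χ x i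
    rw [h0] at this
    exact left_ne_zero_of_mul hχ (by simpa using this.symm)
  · have := key χ y j
    rw [h0] at this
    exact right_ne_zero_of_mul hχ (by simpa using this.symm)

/-- Domains over an algebraically closed field are geometrically integral. -/
theorem tensorProduct_isDomain_of_isAlgClosed (k A B : Type*) [Field k] [IsAlgClosed k]
    [CommRing A] [IsDomain A] [Algebra k A] [CommRing B] [IsDomain B] [Algebra k B] :
    IsDomain (A ⊗[k] B) := by
  have : NoZeroDivisors (A ⊗[k] B) := by
    refine ⟨fun {x y} h => ?_⟩
    -- Only finitely many elements of `B` occur in `x` and `y`, so `B` may be replaced by a finitely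
    -- generated subalgebra; flatness keeps the map of tensor products injective.
    obtain ⟨C, hC, hx⟩ := exists_fg_and_mem_baseChange x
    obtain ⟨C', hC', hy⟩ := exists_fg_and_mem_baseChange y
    have hS : (C ⊔ C').FG := hC.sup hC'
    have : Algebra.FiniteType k (C ⊔ C' : Subalgebra k B) :=
      (Subalgebra.fg_iff_finiteType _).1 hS
    let f : A ⊗[k] (C ⊔ C' : Subalgebra k B) →ₐ[k] A ⊗[k] B :=
      Algebra.TensorProduct.map (AlgHom.id k A) (C ⊔ C').val
    have hf : Function.Injective f :=
      Module.Flat.lTensor_preserves_injective_linearMap _ Subtype.val_injective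
    have hr : ∀ (E : Subalgebra k B) (z : A ⊗[k] B), E ≤ C ⊔ C' → z ∈ E.baseChange A →
        ∃ w, f w = z := by
      rintro E z hE ⟨w, rfl⟩
      refine ⟨Algebra.TensorProduct.map (AlgHom.id k A) (Subalgebra.inclusion hE) w, ?_⟩
      induction w with
      | zero => simp
      | add u v hu hv => simp only [map_add, hu, hv]
      | tmul a m => simp [f]
    obtain ⟨x', rfl⟩ := hr C x le_sup_left hx
    obtain ⟨y', rfl⟩ := hr C' y le_sup_right hy
    rw [← map_mul, map_eq_zero_iff f hf] at h
    have := tensorProduct_noZeroDivisors_of_finiteType (k := k)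
      (Algebra.TensorProduct.comm k _ _ x') (Algebra.TensorProduct.comm k _ _ y')
      (by rw [← map_mul, h, map_zero])
    simpa [map_eq_zero_iff f hf] using this
  have : Nontrivial (A ⊗[k] B) :=
    (Algebra.TensorProduct.includeLeft_injective (R := k) (S := k) (A := A) (B := B)
      (algebraMap k B).injective).nontrivial
  exact NoZeroDivisors.to_isDomain _

/-- Over an algebraically closed field, a free compositum is a linearly disjoint one. -/
theorem productMap_injective_of_algebraicIndependent {k E L Ω ι : Type*} [Field k] [IsAlgClosed k]
    [Field E] [Field L] [Field Ω] [Algebra k E] [Algebra k L] [Algebra k Ω] [Algebra L Ω]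
    [IsScalarTower k L Ω] (f : E →ₐ[k] Ω) (t : ι → E)
    (halg : Algebra.IsAlgebraic (Algebra.adjoin k (Set.range t)) E)
    (hind : AlgebraicIndependent L (fun i => f (t i))) :
    Function.Injective (Algebra.TensorProduct.productMap f (IsScalarTower.toAlgHom k L Ω)) := by
  have : IsDomain (E ⊗[k] L) := tensorProduct_isDomain_of_isAlgClosed k _ _
  let ψ : MvPolynomial ι L →+* E ⊗[k] L :=
    MvPolynomial.eval₂Hom (Algebra.TensorProduct.includeRight : L →ₐ[k] E ⊗[k] L).toRingHom
      (fun i => t i ⊗ₜ[k] 1)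
  let _ := ψ.toAlgebra
  set Φ := Algebra.TensorProduct.productMap f (IsScalarTower.toAlgHom k L Ω) with hΦ
  have hψ : ∀ p : MvPolynomial ι L, Φ (algebraMap _ (E ⊗[k] L) p)
      = MvPolynomial.aeval (fun i => f (t i)) p := by
    intro p
    change Φ (ψ p) = _
    induction p using MvPolynomial.induction_on with
    | C a => simp [ψ, hΦ]
    | add p q hp hq => simp only [map_add, hp, hq]
    | mul_X p i hp => simp only [map_mul, hp]; simp [ψ, hΦ]
  have hk : AlgebraicIndependent k t :=
    (hind.restrictScalars (algebraMap k L).injective).of_comp f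
  -- The tensor product is algebraic over the polynomial ring `L[t]`: the equation of `x` over
  -- `k[t]` is transported along `k[t] → L[t]`.
  have halgE : ∀ x : E, IsAlgebraic (MvPolynomial ι L) (x ⊗ₜ[k] (1 : L)) := by
    intro x
    let g : Algebra.adjoin k (Set.range t) →+* MvPolynomial ι L :=
      (MvPolynomial.map (algebraMap k L)).comp (hk.aevalEquiv.symm : _ →+* MvPolynomial ι k)
    refine IsAlgebraic.ringHom_of_comp_eq g
      (Algebra.TensorProduct.includeLeft : E →ₐ[k] E ⊗[k] L)
      (a := x) (halg.isAlgebraic x)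
      ((MvPolynomial.map_injective _ (algebraMap k L).injective).comp
        hk.aevalEquiv.symm.injective) ?_
    ext s
    obtain ⟨p, rfl⟩ := hk.aevalEquiv.surjective s
    have h1 : g (hk.aevalEquiv p) = MvPolynomial.map (algebraMap k L) p := by simp [g]
    have h2 : (algebraMap (Algebra.adjoin k (Set.range t)) E) (hk.aevalEquiv p)
        = MvPolynomial.aeval t p := by simp
    rw [RingHom.comp_apply, RingHom.coe_coe, h1, RingHom.comp_apply, h2]
    change ψ _ = _
    induction p using MvPolynomial.induction_on with
    | C a =>
      simp only [MvPolynomial.map_C, MvPolynomial.aeval_C]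
      simp only [ψ, MvPolynomial.coe_eval₂Hom, MvPolynomial.eval₂_C]
      exact (AlgHom.commutes (Algebra.TensorProduct.includeRight : L →ₐ[k] E ⊗[k] L) a).trans
        (AlgHom.commutes (Algebra.TensorProduct.includeLeft : E →ₐ[k] E ⊗[k] L) a).symm
    | add p q hp hq => 
      simp only [map_add] at *
      rw [hp (by simp [g]) (by simp), hq (by simp [g]) (by simp)]
    | mul_X p i hp =>
      simp only [map_mul] at *
      rw [hp (by simp [g]) (by simp)]
      simp [ψ]
  have hall : ∀ z : E ⊗[k] L, IsAlgebraic (MvPolynomial ι L) z := by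
    intro z
    induction z with
    | zero => exact isAlgebraic_zero
    | add u v hu hv => exact hu.add hv
    | tmul a m =>
      have : a ⊗ₜ[k] m = (a ⊗ₜ[k] (1 : L)) * algebraMap (MvPolynomial ι L) _
          (MvPolynomial.C m) := by
        change _ = _ * ψ _
        simp [ψ]
      rw [this]
      exact (halgE a).mul (isAlgebraic_algebraMap _)
  -- In a domain algebraic over `L[t]`, a nonzero ideal meets `L[t]` nontrivially. The kernel does
  -- not, since `L[t] → Ω` is injective by `hind`.
  rw [injective_iff_map_eq_zero]
  intro z hz
  by_contra hz0
  refine Ideal.comap_ne_bot_of_algebraic_mem (R := MvPolynomial ι L)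
    (I := RingHom.ker Φ) hz0 hz (hall z) ?_
  rw [eq_bot_iff]
  intro p hp
  have : Φ (algebraMap _ _ p) = 0 := hp
  rw [hψ] at this
  exact (map_eq_zero_iff _ hind).1 this

/-- Over an algebraically closed field, algebraically free extensions are linearly disjoint. -/
theorem linearDisjoint_of_algebraicIndependent {k Ω ι : Type*} [Field k] [IsAlgClosed k] [Field Ω]
    [Algebra k Ω] (E L : IntermediateField k Ω) (t : ι → E)
    (halg : Algebra.IsAlgebraic (Algebra.adjoin k (Set.range t)) E)
    (hind : AlgebraicIndependent L (fun i => (t i : Ω))) : E.LinearDisjoint L := by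
  rw [IntermediateField.linearDisjoint_iff', Subalgebra.linearDisjoint_iff_injective]
  exact productMap_injective_of_algebraicIndependent (L := L) E.val t halg hind

/-- Linear disjointness preserves algebraic independence. -/
theorem algebraicIndependent_of_linearDisjoint {k Ω ι : Type*} [Field k] [Field Ω]
    [Algebra k Ω] {E L : IntermediateField k Ω} (h : E.LinearDisjoint L) {t : ι → E}
    (ht : AlgebraicIndependent k t) : AlgebraicIndependent L (fun i => (t i : Ω)) := by
  -- Algebraic independence is linear independence of the monomials, which linear disjointness
  -- carries from `k` to `L`.
  have h1 : LinearIndependent k (fun m : ι →₀ ℕ => MvPolynomial.aeval t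
      (MvPolynomial.monomial m (1 : k))) := by
    have := (MvPolynomial.basisMonomials ι k).linearIndependent.map'
      (MvPolynomial.aeval t).toLinearMap (LinearMap.ker_eq_bot.2 ht)
    simpa [Function.comp_def] using this
  have h2 := h.linearIndependent_left h1
  have h3 : ∀ m : ι →₀ ℕ, MvPolynomial.aeval (fun i => (t i : Ω))
      (MvPolynomial.monomial m (1 : L)) = (E.val ∘ fun m : ι →₀ ℕ => MvPolynomial.aeval t
      (MvPolynomial.monomial m (1 : k))) m := by
    intro m
    simp [MvPolynomial.aeval_monomial, Finsupp.prod]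
  rw [algebraicIndependent_iff]
  intro p hp
  rw [linearIndependent_iff] at h2
  set b := MvPolynomial.basisMonomials ι L with hb
  refine b.repr.map_eq_zero_iff.1 (h2 _ ?_)
  rw [← hp]
  conv_rhs => rw [← b.linearCombination_repr p]
  have := Finsupp.apply_linearCombination L (MvPolynomial.aeval (fun i => (t i : Ω))).toLinearMap
    b (b.repr p)
  refine Eq.trans ?_ this.symm
  congr 2
  ext m
  rw [← h3]
  simp [hb]

end TensorDomain

/-! ### Linear disjointness of algebraic closures of subfields of K. -/

section Subfields

variable {K Ω : Type*} [Field K] [Field Ω] [Algebra K Ω]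

/-- The subfields `E` and `L` of `Ω` contain `k` and are linearly disjoint over it. -/
def SubfieldLinearDisjoint (k E L : Subfield Ω) : Prop :=
  ∃ (hE : k ≤ E) (hL : k ≤ L),
    (Subfield.extendScalars hE).LinearDisjoint (Subfield.extendScalars hL)

theorem SubfieldLinearDisjoint.symm {k E L : Subfield Ω} (h : SubfieldLinearDisjoint k E L) :
    SubfieldLinearDisjoint k L E :=
  let ⟨hE, hL, H⟩ := h
  ⟨hL, hE, H.symm⟩

theorem SubfieldLinearDisjoint.mono {k E L E' L' : Subfield Ω}
    (h : SubfieldLinearDisjoint k E L) (hE' : k ≤ E') (hL' : k ≤ L') (hEE : E' ≤ E)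
    (hLL : L' ≤ L) : SubfieldLinearDisjoint k E' L' :=
  let ⟨_, _, H⟩ := h
  ⟨hE', hL', H.of_le hEE hLL⟩

theorem SubfieldLinearDisjoint.self_right {k E : Subfield Ω} (h : k ≤ E) :
    SubfieldLinearDisjoint k E k := by
  refine ⟨h, le_rfl, ?_⟩
  have : Subfield.extendScalars (le_refl k) = (⊥ : IntermediateField k Ω) := by
    ext x
    rw [IntermediateField.mem_bot]
    exact ⟨fun hx => ⟨⟨x, hx⟩, rfl⟩, fun ⟨y, hy⟩ => hy ▸ y.2⟩
  exact (IntermediateField.linearDisjoint_iff'.1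
    (IntermediateField.LinearDisjoint.bot_right (Subfield.extendScalars h))
    |> fun H => IntermediateField.linearDisjoint_iff'.2 (this ▸ H))

variable (Ω) in
/-- The relative algebraic closure in `Ω` of a subfield of `K`. -/
noncomputable def algClosureIn (k : Subfield K) : Subfield Ω :=
  (algebraicClosure k Ω).toSubfield

theorem mem_algClosureIn {k : Subfield K} {x : Ω} :
    x ∈ algClosureIn Ω k ↔ IsAlgebraic k x := by
  exact mem_algebraicClosure_iff

theorem algClosureIn_mono {k l : Subfield K} (h : k ≤ l) :
    algClosureIn Ω k ≤ algClosureIn Ω l :=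
  FieldOperators.algebraicClosure_mono h

theorem algebraMap_mem_algClosureIn {k : Subfield K} {x : K} (hx : x ∈ k) :
    algebraMap K Ω x ∈ algClosureIn Ω k :=
  mem_algClosureIn.2 (isAlgebraic_algebraMap (⟨x, hx⟩ : k))

theorem algebraMap_mem_algClosureIn_iff {k : Subfield K} {x : K} :
    algebraMap K Ω x ∈ algClosureIn Ω k ↔ IsAlgebraic k x :=
  mem_algClosureIn.trans (isAlgebraic_algebraMap_iff (algebraMap K Ω).injective)

/-- Transitivity of algebraicity. -/
theorem algClosureIn_le_of_forall_isAlgebraic {k l : Subfield K}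
    (h : ∀ x ∈ l, IsAlgebraic k x) : algClosureIn Ω l ≤ algClosureIn Ω k := by
  intro x hx
  let M : IntermediateField k K := algebraicClosure k K
  have hlM : l ≤ M.toSubfield := fun y hy => mem_algClosureIn.2 (h y hy)
  have hxM : IsAlgebraic M x := mem_algClosureIn.1 (algClosureIn_mono hlM hx)
  exact mem_algClosureIn.2 <| hxM.restrictScalars k

instance isAlgClosed_algClosureIn [IsAlgClosed Ω] (k : Subfield K) :
    IsAlgClosed (algClosureIn Ω k) :=
  (algebraicClosure.isAlgClosure k Ω).isAlgClosed

/-- A subfield `E` that is algebraic over `k(t)`, with `t` algebraically independent over `L`. -/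
theorem subfieldLinearDisjoint_of_algebraicIndependent [IsAlgClosed Ω] {k E L : Subfield K}
    (hE : k ≤ E) (hL : k ≤ L) {ι : Type*} (t : ι → K) (ht : ∀ i, t i ∈ E)
    (halg : ∀ x ∈ E, IsAlgebraic (Subfield.closure (k ∪ Set.range t)) x)
    (hind : AlgebraicIndependent L t) :
    SubfieldLinearDisjoint (algClosureIn Ω k) (algClosureIn Ω E) (algClosureIn Ω L) := by
  refine ⟨algClosureIn_mono hE, algClosureIn_mono hL, ?_⟩
  set k' := algClosureIn Ω k
  set E' := Subfield.extendScalars (algClosureIn_mono (Ω := Ω) hE)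
  let t' : ι → E' := fun i => ⟨algebraMap K Ω (t i), algebraMap_mem_algClosureIn (ht i)⟩
  refine linearDisjoint_of_algebraicIndependent E' _ t' ⟨fun y => ?_⟩ ?_
  -- Algebraicity over the field generated by `k` and `t` is passed up to `k'(t)`, then down to the
  -- ring `k'[t]` demanded by the tensor product criterion.
  · let R : Subalgebra k' Ω := Algebra.adjoin k' (Set.range fun i => algebraMap K Ω (t i))
    let M' : IntermediateField k' Ω :=
      IntermediateField.adjoin k' (Set.range fun i => algebraMap K Ω (t i))
    have h1 : IsAlgebraic (Subfield.closure (k ∪ Set.range t)) (y : Ω) :=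
      mem_algClosureIn.1 (algClosureIn_le_of_forall_isAlgebraic halg y.2)
    have h2 : ∀ z : Subfield.closure ((k : Set K) ∪ Set.range t), algebraMap K Ω z ∈ M' := by
      have : Subfield.closure ((k : Set K) ∪ Set.range t) ≤
          M'.toSubfield.comap (algebraMap K Ω) := by
        rw [Subfield.closure_le]
        rintro z (hz | ⟨i, rfl⟩)
        · exact M'.algebraMap_mem ⟨algebraMap K Ω z, algebraMap_mem_algClosureIn hz⟩
        · exact IntermediateField.subset_adjoin _ _ ⟨i, rfl⟩
      exact fun z => this z.2
    have h3 : IsAlgebraic M' (y : Ω) :=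
      IsAlgebraic.ringHom_of_comp_eq
        (((algebraMap K Ω).comp (Subfield.subtype _)).codRestrict M'.toSubfield h2)
        (RingHom.id Ω) h1 (RingHom.injective _) rfl
    have h4 : IsAlgebraic R (y : Ω) := IntermediateField.isAlgebraic_adjoin_iff.1 h3
    have h5 : (Algebra.adjoin k' (Set.range t')).map E'.val = R := by
      rw [AlgHom.map_adjoin, ← Set.range_comp]
      rfl
    let f : Algebra.adjoin k' (Set.range t') →ₐ[k'] R :=
      (E'.val.comp (Algebra.adjoin k' (Set.range t')).val).codRestrict R
        (fun x => h5 ▸ ⟨x, x.2, rfl⟩)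
    refine IsAlgebraic.of_ringHom_of_comp_eq f E'.val h4 ?_ E'.val.injective rfl
    rintro ⟨x, hx⟩
    rw [← h5] at hx
    obtain ⟨z, hz, rfl⟩ := hx
    exact ⟨⟨z, hz⟩, rfl⟩
  · have h1 : AlgebraicIndependent L (fun i => algebraMap K Ω (t i)) :=
      hind.map' (f := IsScalarTower.toAlgHom L K Ω) (algebraMap K Ω).injective
    exact h1.algebraicClosure

theorem SubfieldLinearDisjoint.algebraicIndependent_of_mem {k E L : Subfield Ω}
    (h : SubfieldLinearDisjoint k E L) {ι : Type*} {t : ι → Ω} (ht : ∀ i, t i ∈ E)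
    (hind : AlgebraicIndependent k t) : AlgebraicIndependent L t := by
  obtain ⟨hE, hL, H⟩ := h
  let t' : ι → Subfield.extendScalars hE := fun i => ⟨t i, ht i⟩
  have h3 : AlgebraicIndependent k t' := hind.of_comp (Subfield.extendScalars hE).val
  have h4 := algebraicIndependent_of_linearDisjoint H h3
  let f : L →+* Subfield.extendScalars hL := RingHom.id L
  exact AlgebraicIndependent.of_ringHom_of_comp_eq f (RingHom.id Ω) h4 f.injective rfl

/-- Converse to `subfieldLinearDisjoint_of_algebraicIndependent`. With both, the algebraic closure
of K disappears and independence is tested on tuples of K over the fields `k` and `L` themselves. -/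
theorem SubfieldLinearDisjoint.algebraicIndependent {k E L : Subfield K}
    (h : SubfieldLinearDisjoint (algClosureIn Ω k) (algClosureIn Ω E) (algClosureIn Ω L))
    {ι : Type*} {t : ι → K} (ht : ∀ i, t i ∈ E)
    (hind : AlgebraicIndependent k t) : AlgebraicIndependent L t := by
  have h1 : AlgebraicIndependent k (fun i => algebraMap K Ω (t i)) :=
    hind.map' (f := IsScalarTower.toAlgHom k K Ω) (algebraMap K Ω).injective
  have h2 : AlgebraicIndependent (algClosureIn Ω k) (fun i => algebraMap K Ω (t i)) :=
    h1.algebraicClosure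
  have h4 := h.algebraicIndependent_of_mem (fun i => algebraMap_mem_algClosureIn (ht i)) h2
  let f : L →+* algClosureIn Ω L := ((algebraMap K Ω).comp L.subtype).codRestrict _
    (fun x => algebraMap_mem_algClosureIn x.2)
  exact AlgebraicIndependent.of_ringHom_of_comp_eq f (algebraMap K Ω) h4 f.injective rfl

end Subfields

namespace FieldOperators

variable {K : Type u} [Field K] {𝔽 : Subfield K} {n : ℕ} {𝒟 : Type v}
  [CommRing 𝒟] [Algebra 𝔽 𝒟] {e : Module.Basis (Fin (n + 1)) 𝔽 𝒟}

/-! ### Operators on products and inverses. -/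

section Matrices

variable (O : FieldOperators 𝔽 e)

/-- The matrix of multiplication by `φ x` on `K ⊗ 𝒟`. -/
noncomputable def mulMatrix (x : K) : Matrix (Fin (n + 1)) (Fin (n + 1)) K :=
  fun k j => ∑ i, (e.repr (e i * e j) k : K) * O.F i x

theorem F_mul_eq (k : Fin (n + 1)) (x y : K) :
    O.F k (x * y) = ∑ j, O.mulMatrix x k j * O.F j y := by
  rw [O.map_mul, Finset.sum_comm]
  refine Finset.sum_congr rfl fun j _ => ?_
  rw [mulMatrix, Finset.sum_mul]
  refine Finset.sum_congr rfl fun i _ => ?_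
  rw [Subfield.smul_def, smul_eq_mul, mul_assoc]

theorem repr_mul_eq (x y : 𝒟) (k : Fin (n + 1)) :
    e.repr (x * y) k = ∑ i, e.repr x i * e.repr (e i * y) k := by
  conv_lhs => rw [← e.sum_repr x]
  simp [Finset.sum_mul, -Module.Basis.sum_repr]

/-- Multiplicativity of φ together with associativity of `𝒟`, the latter written in structure
constants as `hassoc`. -/
theorem mulMatrix_mul (x y : K) : O.mulMatrix (x * y) = O.mulMatrix x * O.mulMatrix y := by
  ext k l
  have hassoc : ∀ i m : Fin (n + 1),
      ∑ p, (e.repr (e i * e m) p : K) * (e.repr (e p * e l) k : K)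
        = ∑ j, (e.repr (e m * e l) j : K) * (e.repr (e i * e j) k : K) := by
    intro i m
    have h1 := repr_mul_eq (e := e) (e i * e m) (e l) k
    have h2 := repr_mul_eq (e := e) (e m * e l) (e i) k
    rw [show e m * e l * e i = e i * e m * e l by ring, h1] at h2
    have h3 := congrArg (Subtype.val : 𝔽 → K) h2
    push_cast at h3
    rw [h3]
    exact Finset.sum_congr rfl fun j _ => by rw [mul_comm (e j)]
  rw [Matrix.mul_apply]
  simp only [mulMatrix, O.map_mul, Subfield.smul_def, smul_eq_mul]
  calc ∑ p, (e.repr (e p * e l) k : K) * ∑ i, ∑ m, (e.repr (e i * e m) p : K) * (O.F i x * O.F m y)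
      = ∑ i, ∑ m, (∑ p, (e.repr (e i * e m) p : K) * (e.repr (e p * e l) k : K))
          * (O.F i x * O.F m y) := by
        simp only [Finset.mul_sum, Finset.sum_mul]
        rw [Finset.sum_comm]
        refine Finset.sum_congr rfl fun i _ => ?_
        rw [Finset.sum_comm]
        refine Finset.sum_congr rfl fun m _ => Finset.sum_congr rfl fun p _ => by ring
    _ = ∑ i, ∑ m, (∑ j, (e.repr (e m * e l) j : K) * (e.repr (e i * e j) k : K))
          * (O.F i x * O.F m y) := by simp only [hassoc]
    _ = _ := by
        simp only [Finset.sum_mul, Finset.mul_sum]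
        rw [Finset.sum_comm]
        conv_rhs => rw [Finset.sum_comm]
        refine Finset.sum_congr rfl fun i _ => ?_
        rw [Finset.sum_comm]
        refine Finset.sum_congr rfl fun m _ => Finset.sum_congr rfl fun p _ => by ring

theorem mulMatrix_one : O.mulMatrix 1 = 1 := by
  ext k j
  have h := repr_mul_eq (e := e) 1 (e j) k
  rw [one_mul, e.repr_self] at h
  have h3 := congrArg (Subtype.val : 𝔽 → K) h
  push_cast at h3
  simp only [mulMatrix, O.map_one]
  rw [Matrix.one_apply]
  calc _ = ∑ i, (e.repr 1 i : K) * (e.repr (e i * e j) k : K) :=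
        Finset.sum_congr rfl fun i _ => mul_comm _ _
    _ = _ := by
      rw [← h3, Finsupp.single_apply]
      simp only [eq_comm (a := j)]
      split_ifs <;> simp

theorem sigma_mul (ρ : 𝒟 →ₐ[𝔽] 𝔽) (x y : K) :
    O.sigma ρ (x * y) = O.sigma ρ x * O.sigma ρ y := by
  have hρ : ∀ i j, ρ (e i) * ρ (e j) = ∑ k, ρ (e k) * e.repr (e i * e j) k := by
    intro i j
    rw [← _root_.map_mul]
    conv_lhs => rw [← e.sum_repr (e i * e j)]
    simp [mul_comm, -Module.Basis.sum_repr]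
  have hρ' : ∀ i j, (ρ (e i) : K) * ρ (e j) = ∑ k, (ρ (e k) : K) * e.repr (e i * e j) k := by
    intro i j
    have := congrArg (Subtype.val : 𝔽 → K) (hρ i j)
    push_cast at this
    exact this
  simp only [sigma, O.map_mul, Subfield.smul_def, smul_eq_mul]
  rw [Finset.sum_mul_sum]
  calc _ = ∑ i, ∑ j, (∑ k, (ρ (e k) : K) * e.repr (e i * e j) k) * (O.F i x * O.F j y) := by
        simp only [Finset.mul_sum, Finset.sum_mul]
        rw [Finset.sum_comm]
        refine Finset.sum_congr rfl fun i _ => ?_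
        rw [Finset.sum_comm]
        refine Finset.sum_congr rfl fun m _ => Finset.sum_congr rfl fun p _ => by ring
    _ = _ := by
        simp only [← hρ']
        refine Finset.sum_congr rfl fun i _ => Finset.sum_congr rfl fun j _ => by ring

theorem sigma_one (ρ : 𝒟 →ₐ[𝔽] 𝔽) : O.sigma ρ 1 = 1 := by
  have h : ∑ k, ρ (e k) * e.repr 1 k = 1 := by
    have := congrArg ρ (e.sum_repr 1)
    simpa [mul_comm, -Module.Basis.sum_repr] using this
  have hK := congrArg (Subtype.val : 𝔽 → K) h
  push_cast at hK
  simp only [sigma, O.map_one, Subfield.smul_def]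
  exact hK

/-- The associated endomorphisms are ring endomorphisms of `K`. -/
noncomputable def sigmaHom (ρ : 𝒟 →ₐ[𝔽] 𝔽) : K →+* K where
  toFun := O.sigma ρ
  map_one' := O.sigma_one ρ
  map_mul' := O.sigma_mul ρ
  map_zero' := by simp [sigma]
  map_add' x y := by simp [sigma, Finset.sum_add_distrib]

/-- The inverse of an associated automorphism. -/
noncomputable def sigmaInvHom (h : O.AssociatedBijective) (ρ : 𝒟 →ₐ[𝔽] 𝔽) : K →+* K :=
  (RingEquiv.ofBijective (O.sigmaHom ρ) (h ρ)).symm.toRingHom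

theorem sigmaInvHom_apply (h : O.AssociatedBijective) (ρ : 𝒟 →ₐ[𝔽] 𝔽) (x : K) :
    O.sigmaInvHom h ρ x = Function.invFun (O.sigma ρ) x := by
  apply (h ρ).1
  rw [Function.rightInverse_invFun (h ρ).2 x]
  exact (RingEquiv.ofBijective (O.sigmaHom ρ) (h ρ)).apply_symm_apply x

/-- Multiplication by φ(x) has a matrix over `kk` which is invertible, with inverse the matrix of
φ(x⁻¹); inverting a matrix does not leave the field of its entries. Applying that inverse to the
coordinates of φ(1) yields the values of the operators at x⁻¹. -/
theorem F_inv_mem {kk : Subfield K} (h𝔽 : 𝔽 ≤ kk) {x : K} (hx : ∀ i, O.F i x ∈ kk)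
    (k : Fin (n + 1)) : O.F k x⁻¹ ∈ kk := by
  rcases eq_or_ne x 0 with rfl | hx0
  · simp [kk.zero_mem]
  have hM : ∀ i j, O.mulMatrix x i j ∈ kk := fun i j =>
    sum_mem fun m _ => mul_mem (h𝔽 (Subtype.coe_prop _)) (hx m)
  let N : Matrix (Fin (n + 1)) (Fin (n + 1)) kk := fun i j => ⟨O.mulMatrix x i j, hM i j⟩
  have hN : N.map kk.subtype = O.mulMatrix x := rfl
  have hinv : O.mulMatrix x⁻¹ * O.mulMatrix x = 1 := by
    rw [← mulMatrix_mul, inv_mul_cancel₀ hx0, mulMatrix_one]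
  have hdet : IsUnit N.det := by
    rw [isUnit_iff_ne_zero]
    intro h0
    have h1 : (O.mulMatrix x).det = 0 := by
      have := kk.subtype.map_det N
      rw [h0, _root_.map_zero] at this
      exact this.symm
    have := congrArg Matrix.det hinv
    rw [Matrix.det_mul, h1] at this
    simp at this
  have h2 : O.mulMatrix x * (N⁻¹).map kk.subtype = 1 := by
    rw [← hN, ← Matrix.map_mul, Matrix.mul_nonsing_inv _ hdet]
    simp
  have h3 : O.mulMatrix x⁻¹ = (N⁻¹).map kk.subtype := left_inv_eq_right_inv hinv h2
  have h4 := O.F_mul_eq k x⁻¹ 1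
  rw [mul_one] at h4
  rw [h4, h3]
  refine sum_mem fun j _ => mul_mem (Subtype.coe_prop (N⁻¹ k j)) ?_
  rw [O.map_one]
  exact h𝔽 (Subtype.coe_prop _)

/-- The elements of the subfield `kk` whose images under the operators and the inverses of
the associated automorphisms lie in `kk`. -/
noncomputable def stable (h : O.AssociatedBijective) (kk : Subfield K) (h𝔽 : 𝔽 ≤ kk) :
    Subfield K where
  carrier := {x | (∀ i, O.F i x ∈ kk) ∧ ∀ ρ, O.sigmaInvHom h ρ x ∈ kk}
  mul_mem' := by
    rintro x y ⟨hx, hx'⟩ ⟨hy, hy'⟩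
    refine ⟨fun i => ?_, fun ρ => by rw [_root_.map_mul]; exact mul_mem (hx' ρ) (hy' ρ)⟩
    rw [O.map_mul]
    refine sum_mem fun i _ => sum_mem fun j _ => ?_
    rw [Subfield.smul_def, smul_eq_mul]
    exact mul_mem (h𝔽 (Subtype.coe_prop _)) (mul_mem (hx i) (hy j))
  one_mem' := ⟨fun i => by rw [O.map_one]; exact h𝔽 (Subtype.coe_prop _),
    fun ρ => by rw [_root_.map_one]; exact one_mem _⟩
  add_mem' := by
    rintro x y ⟨hx, hx'⟩ ⟨hy, hy'⟩
    exact ⟨fun i => by rw [map_add]; exact add_mem (hx i) (hy i),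
      fun ρ => by rw [map_add]; exact add_mem (hx' ρ) (hy' ρ)⟩
  zero_mem' := ⟨fun i => by rw [map_zero]; exact zero_mem _,
    fun ρ => by rw [map_zero]; exact zero_mem _⟩
  neg_mem' := by
    rintro x ⟨hx, hx'⟩
    exact ⟨fun i => by rw [map_neg]; exact neg_mem (hx i),
      fun ρ => by rw [map_neg]; exact neg_mem (hx' ρ)⟩
  inv_mem' := by
    rintro x ⟨hx, hx'⟩
    exact ⟨O.F_inv_mem h𝔽 hx, fun ρ => by rw [map_inv₀]; exact inv_mem (hx' ρ)⟩

end Matrices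

/-! ### Fields closed under the operators, and algebraic closure. -/

section Gen

variable (O : FieldOperators 𝔽 e)

/-- The subfield `kk` is an `O.lang`-substructure. -/
structure IsOpClosed (kk : Subfield K) : Prop where
  base_le : 𝔽 ≤ kk
  F_mem : ∀ i x, x ∈ kk → O.F i x ∈ kk
  sigmaInv_mem : ∀ ρ x, x ∈ kk → Function.invFun (O.sigma ρ) x ∈ kk

/-- An operator-closed subfield, as a substructure. -/
def IsOpClosed.toSubstructure {O : FieldOperators 𝔽 e} {kk : Subfield K} (h : O.IsOpClosed kk) :
    O.lang.Substructure K where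
  carrier := kk
  fun_mem {m} f := by
    intro x hx
    change OpFunctions 𝔽 n 𝒟 m at f
    cases f with
    | zero => exact kk.zero_mem
    | one => exact kk.one_mem
    | const c => exact h.base_le c.2
    | neg => exact kk.neg_mem (hx 0)
    | add => exact kk.add_mem (hx 0) (hx 1)
    | mul => exact kk.mul_mem (hx 0) (hx 1)
    | op i => exact h.F_mem _ _ (hx 0)
    | sigmaInv ρ => exact h.sigmaInv_mem _ _ (hx 0)

theorem subset_gen (A : Set K) : A ⊆ O.gen A :=
  (FirstOrder.Language.Substructure.subset_closure (L := O.lang)).trans Subfield.subset_closure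

theorem gen_le {O : FieldOperators 𝔽 e} {A : Set K} {kk : Subfield K} (h : O.IsOpClosed kk)
    (hA : A ⊆ kk) : O.gen A ≤ kk := by
  rw [gen, Subfield.closure_le]
  exact (FirstOrder.Language.Substructure.closure_le (S := h.toSubstructure)).2 hA

theorem base_le_gen (A : Set K) : 𝔽 ≤ O.gen A := by
  intro c hc
  refine Subfield.subset_closure ?_
  exact (FirstOrder.Language.Substructure.closure O.lang A).fun_mem
    (OpFunctions.const ⟨c, hc⟩ : OpFunctions 𝔽 n 𝒟 0) ![] (by simp)

theorem isOpClosed_of_le_stable {O : FieldOperators 𝔽 e} (h : O.AssociatedBijective)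
    {kk : Subfield K} (h𝔽 : 𝔽 ≤ kk) (hle : kk ≤ O.stable h kk h𝔽) : O.IsOpClosed kk where
  base_le := h𝔽
  F_mem i x hx := (hle hx).1 i
  sigmaInv_mem ρ x hx := by
    rw [← O.sigmaInvHom_apply h]
    exact (hle hx).2 ρ

theorem IsOpClosed.le_stable {O : FieldOperators 𝔽 e} (h : O.AssociatedBijective)
    {kk l : Subfield K} (hk : O.IsOpClosed kk) (hkl : kk ≤ l) (h𝔽 : 𝔽 ≤ l) :
    kk ≤ O.stable h l h𝔽 := fun x hx =>
  ⟨fun i => hkl (hk.F_mem i x hx), fun ρ => by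
    rw [O.sigmaInvHom_apply h]
    exact hkl (hk.sigmaInv_mem ρ x hx)⟩

/-- `gen` adds only quotients to a substructure. The elements sent into `gen A` by all symbols form
a subfield, `stable`, so checking the substructure is enough. -/
theorem isOpClosed_gen (h : O.AssociatedBijective) (A : Set K) : O.IsOpClosed (O.gen A) := by
  refine isOpClosed_of_le_stable h (O.base_le_gen A) ?_
  conv_lhs => rw [gen]
  rw [Subfield.closure_le]
  intro x hx
  refine ⟨fun i => Subfield.subset_closure ?_, fun ρ => Subfield.subset_closure ?_⟩
  · refine Fin.cases ?_ (fun i => ?_) i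
    · rw [O.F_zero]; exact hx
    · exact (FirstOrder.Language.Substructure.closure O.lang A).fun_mem
        (OpFunctions.op i : OpFunctions 𝔽 n 𝒟 1) ![x] (by simpa using hx)
  · rw [O.sigmaInvHom_apply h]
    exact (FirstOrder.Language.Substructure.closure O.lang A).fun_mem
        (OpFunctions.sigmaInv ρ : OpFunctions 𝔽 n 𝒟 1) ![x] (by simpa using hx)

/-- A compositum of operator-closed subfields is operator-closed. -/
theorem gen_union (h : O.AssociatedBijective) (A B : Set K) :
    O.gen (A ∪ B) = O.gen A ⊔ O.gen B := by
  apply le_antisymm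
  -- As `stable` of the compositum is a subfield, it contains the compositum once it contains both
  -- factors.
  · refine gen_le (isOpClosed_of_le_stable h ((O.base_le_gen A).trans le_sup_left)
      (sup_le ?_ ?_)) (Set.union_subset ?_ ?_)
    · exact (O.isOpClosed_gen h A).le_stable h le_sup_left _
    · exact (O.isOpClosed_gen h B).le_stable h le_sup_right _
    · exact (O.subset_gen A).trans (le_sup_left : O.gen A ≤ O.gen A ⊔ O.gen B)
    · exact (O.subset_gen B).trans (le_sup_right : O.gen B ≤ O.gen A ⊔ O.gen B)
  · exact sup_le (O.gen_mono Set.subset_union_left) (O.gen_mono Set.subset_union_right)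

/-- The image of a finite definable set under a basic function is finite and definable. As acl is
`algIn`, this closes `algIn A` under the operators without extending them to algebraic extensions.
-/
theorem acl_closed_of_unary {A : Set K} (f : O.lang.Functions 1) {x : K} (hx : x ∈ O.acl A) :
    FirstOrder.Language.Structure.funMap f ![x] ∈ O.acl A := by
  obtain ⟨S, hS, hfin, hxS⟩ := hx
  refine ⟨(fun y => FirstOrder.Language.Structure.funMap f ![y]) '' S, ?_, hfin.image _,
    x, hxS, rfl⟩
  have h1 : A.Definable O.lang {v : Fin 2 → K | v 0 ∈ S} :=
    Set.Definable.preimage_comp (fun _ : Fin 1 => (0 : Fin 2)) hS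
  have h2 : A.Definable O.lang
      {v : Fin 2 → K | FirstOrder.Language.Structure.funMap f ![v 0] = v 1} := by
    refine Set.Definable.mono (A := ∅) ?_ (Set.empty_subset _)
    rw [Set.empty_definable_iff]
    refine ⟨(FirstOrder.Language.Term.func f ![FirstOrder.Language.Term.var 0]).equal
      (FirstOrder.Language.Term.var 1), ?_⟩
    ext v
    simp only [Set.mem_ofPred_eq, FirstOrder.Language.Formula.realize_equal,
      FirstOrder.Language.Term.realize_func, FirstOrder.Language.Term.realize_var]
    have : (![v 0] : Fin 1 → K) = fun i => FirstOrder.Language.Term.realize v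
        ((![FirstOrder.Language.Term.var 0] : Fin 1 → O.lang.Term (Fin 2)) i) := by
      ext i; fin_cases i; rfl
    rw [this]
  have h3 := (h1.inter h2).image_comp (fun _ : Fin 1 => (1 : Fin 2))
  unfold Set.Definable₁
  convert h3 using 1
  ext v
  constructor
  · rintro ⟨y, hy, hyv⟩
    refine ⟨![y, v 0], ⟨hy, hyv⟩, ?_⟩
    ext i
    rw [Subsingleton.elim i 0]
    rfl
  · rintro ⟨w, ⟨hw, hw'⟩, rfl⟩
    exact ⟨w 0, hw, hw'⟩

theorem alg_eq (A : Set K) : O.alg A = algClosureIn (AlgebraicClosure K) (O.gen A) := rfl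

/-- `O.algIn A`, as a subfield of `K`. -/
noncomputable def algField (A : Set K) : Subfield K :=
  (O.alg A).comap (algebraMap K (AlgebraicClosure K))

theorem mem_algIn {A : Set K} {x : K} : x ∈ O.algIn A ↔ IsAlgebraic (O.gen A) x :=
  algebraMap_mem_algClosureIn_iff

theorem gen_subset_algIn (A : Set K) : (O.gen A : Set K) ⊆ O.algIn A := fun x hx =>
  O.mem_algIn.2 (isAlgebraic_algebraMap (⟨x, hx⟩ : O.gen A))

theorem subset_algIn (A : Set K) : A ⊆ O.algIn A := (O.subset_gen A).trans (O.gen_subset_algIn A)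

theorem algIn_mono {A B : Set K} (h : A ⊆ B) : O.algIn A ⊆ O.algIn B :=
  Set.preimage_mono (O.alg_mono h)

theorem isOpClosed_algField (hT : O.TypesDetermined) (A : Set K) :
    O.IsOpClosed (O.algField A) where
  base_le := fun x hx => O.gen_subset_algIn A (O.base_le_gen A hx)
  F_mem i x hx := by
    refine Fin.cases ?_ (fun i => ?_) i
    · rw [O.F_zero]; exact hx
    · change _ ∈ O.algIn A
      have hx' : x ∈ O.algIn A := hx
      rw [← hT.acl_eq] at hx' ⊢
      exact O.acl_closed_of_unary (OpFunctions.op i : OpFunctions 𝔽 n 𝒟 1) hx'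
  sigmaInv_mem ρ x hx := by
    change _ ∈ O.algIn A
    have hx' : x ∈ O.algIn A := hx
    rw [← hT.acl_eq] at hx' ⊢
    exact O.acl_closed_of_unary (OpFunctions.sigmaInv ρ : OpFunctions 𝔽 n 𝒟 1) hx'

theorem alg_le_alg (hT : O.TypesDetermined) {A B : Set K} (h : A ⊆ O.algIn B) :
    O.alg A ≤ O.alg B := by
  refine (algClosureIn_mono (gen_le (O.isOpClosed_algField hT B) h)).trans ?_
  exact algClosureIn_le_of_forall_isAlgebraic fun x hx => O.mem_algIn.1 hx

theorem algIn_subset_algIn (hT : O.TypesDetermined) {A B : Set K} (h : A ⊆ O.algIn B) :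
    O.algIn A ⊆ O.algIn B :=
  Set.preimage_mono (O.alg_le_alg hT h)

theorem algIn_algIn (hT : O.TypesDetermined) (A : Set K) : O.algIn (O.algIn A) = O.algIn A :=
  (O.algIn_subset_algIn hT subset_rfl).antisymm (O.subset_algIn _)

end Gen

end FieldOperators

/-! ### Transcendence bases and the calculus of independence. -/

theorem exists_algebraicIndependent_of_closure {K : Type*} [Field K] (k : Subfield K) (S : Set K) :
    ∃ T ⊆ S, AlgebraicIndependent k ((↑) : T → K) ∧
      ∀ x ∈ Subfield.closure ((k : Set K) ∪ S),
        IsAlgebraic (Subfield.closure ((k : Set K) ∪ T)) x := by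
  -- The basis is drawn from `S` itself, so that when `S` is a substructure its members are values
  -- of terms.
  obtain ⟨T, hT⟩ := (AlgebraicIndependent.matroid k K).exists_isBasis S
  rw [AlgebraicIndependent.matroid_isBasis_iff] at hT
  obtain ⟨hT1, hT2, hT3⟩ := hT
  refine ⟨T, hT2, hT1, ?_⟩
  suffices h : Subfield.closure ((k : Set K) ∪ S) ≤
      algClosureIn K (Subfield.closure ((k : Set K) ∪ T)) from
    fun x hx => mem_algClosureIn.1 (h hx)
  rw [Subfield.closure_le]
  rintro x (hx | hx)
  · exact algebraMap_mem_algClosureIn (Subfield.subset_closure (Or.inl hx))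
  · have h1 : IsAlgebraic (IntermediateField.adjoin k T) x :=
      IntermediateField.isAlgebraic_adjoin_iff.2 (hT3 x hx)
    have h2 : (IntermediateField.adjoin k T).toSubfield ≤
        Subfield.closure ((k : Set K) ∪ T) := by
      change Subfield.closure _ ≤ _
      refine Subfield.closure_mono (Set.union_subset_union_left _ ?_)
      rintro _ ⟨y, rfl⟩
      exact y.2
    exact algClosureIn_mono h2 (mem_algClosureIn.2 h1)

namespace FieldOperators

variable {K : Type u} [Field K] {𝔽 : Subfield K} {n : ℕ} {𝒟 : Type v}
  [CommRing 𝒟] [Algebra 𝔽 𝒟] {e : Module.Basis (Fin (n + 1)) 𝔽 𝒟} {O : FieldOperators 𝔽 e}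

section Calculus

theorem indep_iff {A B C : Set K} :
    O.Indep A C B ↔ SubfieldLinearDisjoint (O.alg C) (O.alg (A ∪ C)) (O.alg (B ∪ C)) :=
  ⟨fun h => ⟨_, _, h⟩, fun ⟨_, _, h⟩ => h⟩

theorem Indep.symm {A B C : Set K} (h : O.Indep A C B) : O.Indep B C A :=
  indep_iff.2 (indep_iff.1 h).symm

theorem alg_eq_of {A B : Set K} (hT : O.TypesDetermined) (h : A ⊆ O.algIn B)
    (h' : B ⊆ O.algIn A) : O.alg A = O.alg B :=
  (O.alg_le_alg hT h).antisymm (O.alg_le_alg hT h')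

theorem subset_algIn_union_left (A B : Set K) : A ⊆ O.algIn (A ∪ B) :=
  Set.subset_union_left.trans (O.subset_algIn _)

theorem subset_algIn_union_right (A B : Set K) : B ⊆ O.algIn (A ∪ B) :=
  Set.subset_union_right.trans (O.subset_algIn _)

theorem Indep.mono (hT : O.TypesDetermined) {A B C A' B' : Set K} (h : O.Indep A C B)
    (hA : A' ⊆ O.algIn (A ∪ C)) (hB : B' ⊆ O.algIn (B ∪ C)) : O.Indep A' C B' :=
  indep_iff.2 ((indep_iff.1 h).mono (O.alg_mono Set.subset_union_right)
    (O.alg_mono Set.subset_union_right)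
    (O.alg_le_alg hT (Set.union_subset hA (subset_algIn_union_right _ _)))
    (O.alg_le_alg hT (Set.union_subset hB (subset_algIn_union_right _ _))))

theorem indep_of_subset_algIn (hT : O.TypesDetermined) {A B C : Set K} (h : B ⊆ O.algIn C) :
    O.Indep A C B := by
  refine indep_iff.2 ?_
  have : O.alg (B ∪ C) = O.alg C :=
    alg_eq_of hT (Set.union_subset h (O.subset_algIn C)) (subset_algIn_union_right _ _)
  rw [this]
  exact SubfieldLinearDisjoint.self_right (O.alg_mono Set.subset_union_right)

theorem Indep.algebraicIndependent {A B C : Set K} (h : O.Indep A C B) {ι : Type*} {t : ι → K}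
    (ht : ∀ i, t i ∈ O.gen (A ∪ C)) (hind : AlgebraicIndependent (O.gen C) t) :
    AlgebraicIndependent (O.gen (B ∪ C)) t := by
  have h' := indep_iff.1 h
  rw [alg_eq, alg_eq, alg_eq] at h'
  exact h'.algebraicIndependent ht hind

theorem indep_of_algebraicIndependent {A B C : Set K} {ι : Type*} (t : ι → K)
    (ht : ∀ i, t i ∈ O.gen (A ∪ C))
    (halg : ∀ x ∈ O.gen (A ∪ C),
      IsAlgebraic (Subfield.closure ((O.gen C : Set K) ∪ Set.range t)) x)
    (hind : AlgebraicIndependent (O.gen (B ∪ C)) t) : O.Indep A C B :=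
  indep_iff.2 (subfieldLinearDisjoint_of_algebraicIndependent
    (O.gen_mono Set.subset_union_right) (O.gen_mono Set.subset_union_right) t ht halg hind)

/-- A transcendence basis of `gen (A ∪ C)` over `gen C` stays independent over `gen (B ∪ C')`. It
still has the right algebraic span over `gen C'`, because `gen (A ∪ C')` is the compositum of `gen
(A ∪ C)` and `gen C'`. -/
theorem Indep.base_mono (hE : O.AssociatedBijective) (hT : O.TypesDetermined) {A B C C' : Set K}
    (h : O.Indep A C B) (hC : C ⊆ C') (hC' : C' ⊆ O.algIn (B ∪ C)) : O.Indep A C' B := by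
  have h' : O.Indep A C (B ∪ C') :=
    h.mono hT (subset_algIn_union_left _ _) (Set.union_subset (subset_algIn_union_left _ _) hC')
  obtain ⟨T, hTs, hTi, hTa⟩ :=
    exists_algebraicIndependent_of_closure (O.gen C) (O.gen (A ∪ C) : Set K)
  have h1 := h'.algebraicIndependent (t := ((↑) : T → K)) (fun i => hTs i.2) hTi
  have hBC : B ∪ C' ∪ C = B ∪ C' := Set.union_eq_self_of_subset_right
    (hC.trans Set.subset_union_right)
  rw [hBC] at h1
  refine indep_of_algebraicIndependent ((↑) : T → K)
    (fun i => O.gen_mono (Set.union_subset_union_right _ hC) (hTs i.2)) ?_ h1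
  suffices hs : O.gen (A ∪ C') ≤
      algClosureIn K (Subfield.closure ((O.gen C' : Set K) ∪ Set.range ((↑) : T → K))) from
    fun x hx => mem_algClosureIn.1 (hs hx)
  have hAC : A ∪ C' = (A ∪ C) ∪ C' := by
    rw [Set.union_assoc, Set.union_eq_self_of_subset_left hC]
  rw [hAC, O.gen_union hE, Subtype.range_coe]
  refine sup_le (fun x hx => ?_) (fun x hx =>
    algebraMap_mem_algClosureIn (Subfield.subset_closure (Or.inl hx)))
  exact algClosureIn_mono (Subfield.closure_mono (Set.union_subset_union_left _ (O.gen_mono hC)))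
    (mem_algClosureIn.2 (hTa x (Subfield.subset_closure (Or.inr hx))))

/-- The finite witness against independence on which transitivity, invariance under automorphisms,
finite character and definability of dependence all rest. It lies in the substructure, not just in
its fraction field, so terms describe it. -/
theorem exists_dependent_of_not_indep {A B C : Set K} (h : ¬ O.Indep A C B) :
    ∃ (r : ℕ) (t : Fin r → K),
      (∀ i, t i ∈ FirstOrder.Language.Substructure.closure O.lang (A ∪ C)) ∧
      AlgebraicIndependent (O.gen C) t ∧ ¬ AlgebraicIndependent (O.gen (B ∪ C)) t := by
  obtain ⟨T, hTs, hTi, hTa⟩ := exists_algebraicIndependent_of_closure (O.gen C)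
    (FirstOrder.Language.Substructure.closure O.lang (A ∪ C) : Set K)
  have hnot : ¬ AlgebraicIndependent (O.gen (B ∪ C)) ((↑) : T → K) := by
    intro hind
    refine h (indep_of_algebraicIndependent ((↑) : T → K)
      (fun i => Subfield.subset_closure (hTs i.2)) (fun x hx => ?_) hind)
    rw [Subtype.range_coe]
    exact hTa x (Subfield.closure_mono Set.subset_union_right hx)
  obtain ⟨T₀, hT₀, hfin, hdep⟩ : ∃ T₀ ⊆ T, T₀.Finite ∧
      ¬ AlgebraicIndependent (O.gen (B ∪ C)) ((↑) : T₀ → K) := by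
    by_contra! hc
    exact hnot (algebraicIndependent_of_finite T hc)
  have := hfin.fintype
  let eq := Fintype.equivFin T₀
  refine ⟨Fintype.card T₀, fun i => (eq.symm i : K), fun i => hTs (hT₀ (eq.symm i).2), ?_, ?_⟩
  · exact (hTi.mono hT₀).comp eq.symm eq.symm.injective
  · intro hind
    refine hdep ?_
    have := hind.comp eq eq.injective
    simpa [Function.comp_def] using this

theorem Indep.trans {A B C E : Set K}
    (h : O.Indep A C B) (h' : O.Indep A (C ∪ B) E) : O.Indep A C (B ∪ E) := by
  by_contra hn
  obtain ⟨r, t, ht, hi, hd⟩ := exists_dependent_of_not_indep hn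
  apply hd
  have ht' : ∀ i, t i ∈ O.gen (A ∪ C) := fun i => Subfield.subset_closure (ht i)
  have h1 := h.algebraicIndependent ht' hi
  rw [Set.union_comm B C] at h1
  have h2 := h'.algebraicIndependent
    (fun i => O.gen_mono (Set.union_subset_union_right _ Set.subset_union_left) (ht' i)) h1
  have : E ∪ (C ∪ B) = B ∪ E ∪ C := by
    ext x; simp only [Set.mem_union]; tauto
  rwa [this] at h2

theorem exists_finite_of_mem_algIn (hT : O.TypesDetermined) {A : Set K} {x : K}
    (hx : x ∈ O.algIn A) : ∃ A₀ ⊆ A, A₀.Finite ∧ x ∈ O.algIn A₀ := by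
  rw [← hT.acl_eq] at hx
  obtain ⟨S, hS, hfin, hxS⟩ := hx
  obtain ⟨A₀, hA₀, hdef⟩ := Set.definable_iff_finitely_definable.1 hS
  refine ⟨A₀, hA₀, A₀.finite_toSet, ?_⟩
  rw [← hT.acl_eq]
  exact ⟨S, hdef, hfin, hxS⟩

theorem indep_of_forall_finite (hT : O.TypesDetermined) {A B C : Set K}
    (h : ∀ A₀ ⊆ A, A₀.Finite → O.Indep A₀ C B) : O.Indep A C B := by
  by_contra hn
  obtain ⟨r, t, ht, hi, hd⟩ := exists_dependent_of_not_indep hn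
  have h1 : ∀ i, ∃ A₀ ⊆ A ∪ C, A₀.Finite ∧ t i ∈ O.algIn A₀ := fun i =>
    exists_finite_of_mem_algIn hT (O.gen_subset_algIn _ (Subfield.subset_closure (ht i)))
  choose A₀ hA₀ hfin hmem using h1
  have h2 := h ((⋃ i, A₀ i) ∩ A) Set.inter_subset_right
    ((Set.finite_iUnion hfin).subset Set.inter_subset_left)
  -- The witness is only algebraic over the finite set and `C`, so the left side is first enlarged
  -- to their algebraic closure.
  have h3 := h2.mono hT (A' := O.algIn ((⋃ i, A₀ i) ∩ A ∪ C)) subset_rfl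
    (subset_algIn_union_left _ _)
  refine hd (h3.algebraicIndependent (fun i => ?_) hi)
  refine O.gen_mono Set.subset_union_left (O.subset_gen _ (O.algIn_mono ?_ (hmem i)))
  intro x hx
  rcases hA₀ i hx with hxA | hxC
  · exact Or.inl ⟨Set.mem_iUnion.2 ⟨i, hx⟩, hxA⟩
  · exact Or.inr hxC

end Calculus

end FieldOperators

namespace FieldOperators

variable {K : Type u} [Field K] {𝔽 : Subfield K} {n : ℕ} {𝒟 : Type v}
  [CommRing 𝒟] [Algebra 𝔽 𝒟] {e : Module.Basis (Fin (n + 1)) 𝔽 𝒟} {O : FieldOperators 𝔽 e}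

/-! ### Automorphisms, types and homogeneity. -/

section Automorphisms

theorem aut_add (f : K ≃[O.lang] K) (x y : K) : f (x + y) = f x + f y := by
  have := FirstOrder.Language.HomClass.map_fun f (OpFunctions.add : OpFunctions 𝔽 n 𝒟 2) ![x, y]
  exact this

theorem aut_mul (f : K ≃[O.lang] K) (x y : K) : f (x * y) = f x * f y := by
  have := FirstOrder.Language.HomClass.map_fun f (OpFunctions.mul : OpFunctions 𝔽 n 𝒟 2) ![x, y]
  exact this

theorem aut_base (f : K ≃[O.lang] K) (c : 𝔽) : f c = c := by
  have := FirstOrder.Language.HomClass.map_fun f (OpFunctions.const c : OpFunctions 𝔽 n 𝒟 0) ![]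
  exact this

theorem aut_F (f : K ≃[O.lang] K) (i : Fin (n + 1)) (x : K) : f (O.F i x) = O.F i (f x) := by
  refine Fin.cases ?_ (fun i => ?_) i
  · rw [O.F_zero]; rfl
  · have := FirstOrder.Language.HomClass.map_fun f (OpFunctions.op i : OpFunctions 𝔽 n 𝒟 1) ![x]
    exact this

theorem aut_sigmaInv (f : K ≃[O.lang] K) (ρ : 𝒟 →ₐ[𝔽] 𝔽) (x : K) :
    f (Function.invFun (O.sigma ρ) x) = Function.invFun (O.sigma ρ) (f x) := by
  have := FirstOrder.Language.HomClass.map_fun f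
    (OpFunctions.sigmaInv ρ : OpFunctions 𝔽 n 𝒟 1) ![x]
  exact this

/-- An automorphism of the structure `K` as a field automorphism. -/
def autRing (f : K ≃[O.lang] K) : K ≃+* K :=
  { f.toEquiv with
    map_mul' := aut_mul f
    map_add' := aut_add f }

theorem aut_mem_gen (hE : O.AssociatedBijective) (f : K ≃[O.lang] K) {A : Set K} {x : K}
    (hx : x ∈ O.gen A) : f x ∈ O.gen (f '' A) := by
  have hc := O.isOpClosed_gen hE (f '' A)
  have : O.gen A ≤ (O.gen (f '' A)).comap (autRing f).toRingHom := by
    refine gen_le ⟨?_, ?_, ?_⟩ ?_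
    · intro c hc'
      change f c ∈ O.gen (f '' A)
      rw [aut_base f ⟨c, hc'⟩]
      exact O.base_le_gen _ hc'
    · intro i y hy
      change f (O.F i y) ∈ O.gen (f '' A)
      rw [aut_F]
      exact hc.F_mem _ _ hy
    · intro i y hy
      change f (Function.invFun (O.sigma i) y) ∈ O.gen (f '' A)
      rw [aut_sigmaInv]
      exact hc.sigmaInv_mem _ _ hy
    · exact fun y hy => O.subset_gen _ ⟨y, hy, rfl⟩
  exact this hx

theorem symm_image_image (f : K ≃[O.lang] K) (A : Set K) : f.symm '' (f '' A) = A := by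
  rw [← Set.image_comp]
  exact (Set.image_congr' fun x => f.symm_apply_apply x).trans (Set.image_id A)

theorem symm_mem_gen (hE : O.AssociatedBijective) (f : K ≃[O.lang] K) {A : Set K} {x : K}
    (hx : x ∈ O.gen (f '' A)) : f.symm x ∈ O.gen A := by
  have := aut_mem_gen hE f.symm hx
  rwa [symm_image_image] at this

theorem algebraicIndependent_aut_iff (hE : O.AssociatedBijective) (f : K ≃[O.lang] K) {A : Set K}
    {ι : Type*} {t : ι → K} :
    AlgebraicIndependent (O.gen (f '' A)) (fun i => f (t i)) ↔ AlgebraicIndependent (O.gen A) t := by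
  let g : O.gen A →+* O.gen (f '' A) :=
    ((autRing f).toRingHom.comp (O.gen A).subtype).codRestrict _ (fun x => aut_mem_gen hE f x.2)
  have hg : Function.Surjective g := by
    rintro ⟨y, hy⟩
    exact ⟨⟨f.symm y, symm_mem_gen hE f hy⟩, Subtype.ext (f.apply_symm_apply y)⟩
  constructor
  · intro h
    exact AlgebraicIndependent.of_ringHom_of_comp_eq g (autRing f) h g.injective rfl
  · intro h
    exact AlgebraicIndependent.ringHom_of_comp_eq g (autRing f) h hg (autRing f).injective rfl

theorem Indep.map (hE : O.AssociatedBijective) (f : K ≃[O.lang] K) {A B C : Set K}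
    (h : O.Indep A C B) : O.Indep (f '' A) (f '' C) (f '' B) := by
  by_contra hn
  obtain ⟨r, t, ht, hi, hd⟩ := exists_dependent_of_not_indep hn
  apply hd
  have ht' : ∀ i, t i = f (f.symm (t i)) := fun i => (f.apply_symm_apply _).symm
  have h1 : ∀ i, f.symm (t i) ∈ O.gen (A ∪ C) := by
    intro i
    apply symm_mem_gen hE f
    rw [Set.image_union]
    exact Subfield.subset_closure (ht i)
  rw [funext ht'] at hi ⊢
  rw [algebraicIndependent_aut_iff hE f] at hi
  rw [← Set.image_union, algebraicIndependent_aut_iff hE f]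
  exact h.algebraicIndependent h1 hi

theorem sameType_iff_formula {A : Set K} {ι : Type*} {a b : ι → K} :
    O.SameType A a b ↔ ∀ φ : O.lang.Formula (A ⊕ ι),
      φ.Realize (Sum.elim (↑) a) ↔ φ.Realize (Sum.elim (↑) b) := by
  have key : ∀ (φ : (O.lang[[A]]).Formula ι) (c : ι → K),
      FirstOrder.Language.Formula.Realize (M := K)
        (FirstOrder.Language.BoundedFormula.constantsVarsEquiv φ : O.lang.Formula (A ⊕ ι))
        (Sum.elim (↑) c) ↔ φ.Realize c := by
    intro φ c
    have := FirstOrder.Language.BoundedFormula.realize_constantsVarsEquiv (M := K) (φ := φ)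
      (v := c) (xs := default)
    simpa [FirstOrder.Language.Formula.Realize] using this
  constructor
  · intro h φ
    obtain ⟨ψ, rfl⟩ := (FirstOrder.Language.BoundedFormula.constantsVarsEquiv).surjective φ
    exact (key ψ a).trans ((h ψ).trans (key ψ b).symm)
  · intro h ψ
    exact (key ψ a).symm.trans ((h _).trans (key ψ b))

theorem sameType_of_aut {A : Set K} {ι : Type*} {a b : ι → K} (f : K ≃[O.lang] K)
    (hA : ∀ x ∈ A, f x = x) (hab : ∀ i, f (a i) = b i) : O.SameType A a b := by
  rw [sameType_iff_formula]
  intro φ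
  have h1 : (Sum.elim (↑) b : A ⊕ ι → K) = f ∘ Sum.elim (↑) a := by
    ext i
    rcases i with i | i
    · exact (hA i i.2).symm
    · exact (hab i).symm
  rw [h1]
  exact (FirstOrder.Language.StrongHomClass.realize_formula f φ).symm

theorem SameType.symm {A : Set K} {ι : Type*} {a b : ι → K} (h : O.SameType A a b) :
    O.SameType A b a := fun φ => (h φ).symm

theorem SameType.trans {A : Set K} {ι : Type*} {a b c : ι → K} (h : O.SameType A a b)
    (h' : O.SameType A b c) : O.SameType A a c := fun φ => (h φ).trans (h' φ)

/-- Homogeneity is given for types over ∅, so the parameter set is enumerated and appended to the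
tuple; `ULift` places the index set in the universe of `κ`. -/
theorem SameType.exists_aut {κ : Cardinal.{u}} (hS : O.SufficientlySaturated κ) {A : Set K}
    (hA : #A < κ) {m : ℕ} {a b : Fin m → K} (h : O.SameType A a b) :
    ∃ f : K ≃[O.lang] K, (∀ x ∈ A, f x = x) ∧ ∀ i, f (a i) = b i := by
  have hcard : #(A ⊕ ULift.{u} (Fin m)) < κ := by
    rw [Cardinal.mk_sum]
    simp only [Cardinal.lift_id]
    exact Cardinal.add_lt_of_lt hS.aleph0_lt.le hA
      (lt_of_lt_of_le (Cardinal.lt_aleph0_of_finite _) hS.aleph0_lt.le)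
  have htype : O.SameType ∅ (Sum.elim (↑) (a ∘ ULift.down) : A ⊕ ULift.{u} (Fin m) → K)
      (Sum.elim (↑) (b ∘ ULift.down)) := by
    rw [sameType_iff_formula]
    intro φ
    rw [sameType_iff_formula] at h
    let g : (∅ : Set K) ⊕ (A ⊕ ULift.{u} (Fin m)) → A ⊕ Fin m :=
      Sum.elim (fun x => x.2.elim) (Sum.map id ULift.down)
    have key : ∀ c : Fin m → K, (φ.relabel g).Realize (M := K) (Sum.elim (↑) c) ↔
        φ.Realize (Sum.elim (↑) (Sum.elim (↑) (c ∘ ULift.down))) := by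
      intro c
      rw [FirstOrder.Language.Formula.realize_relabel]
      have : (Sum.elim (↑) c ∘ g : _ → K) = Sum.elim (↑) (Sum.elim (↑) (c ∘ ULift.down)) := by
        ext i
        rcases i with i | i | i
        · exact i.2.elim
        · rfl
        · rfl
      rw [this]
    exact (key a).symm.trans ((h _).trans (key b))
  obtain ⟨f, hf⟩ := hS.homogeneous _ _ _ hcard htype
  exact ⟨f, fun x hx => hf (Sum.inl ⟨x, hx⟩), fun i => hf (Sum.inr ⟨i⟩)⟩

end Automorphisms

end FieldOperators

namespace FieldOperators

variable {K : Type u} [Field K] {𝔽 : Subfield K} {n : ℕ} {𝒟 : Type v}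
  [CommRing 𝒟] [Algebra 𝔽 𝒟] {e : Module.Basis (Fin (n + 1)) 𝔽 𝒟} {O : FieldOperators 𝔽 e}

/-! ### Smallness of generated sets. -/

section Cardinality

variable {κ : Cardinal.{u}}

/-- A code for the function symbols of the language. -/
noncomputable def functionCode (e : Module.Basis (Fin (n + 1)) 𝔽 𝒟) :
    (Σ i, OpFunctions 𝔽 n 𝒟 i) → ℕ ⊕ 𝔽 ⊕ (Fin (n + 1) → 𝔽)
  | ⟨_, .zero⟩ => .inl 0
  | ⟨_, .one⟩ => .inl 1
  | ⟨_, .neg⟩ => .inl 2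
  | ⟨_, .add⟩ => .inl 3
  | ⟨_, .mul⟩ => .inl 4
  | ⟨_, .op i⟩ => .inl (5 + i)
  | ⟨_, .const c⟩ => .inr (.inl c)
  | ⟨_, .sigmaInv ρ⟩ => .inr (.inr fun i => ρ (e i))

/-- `𝒟` may live in another universe than `κ`. Since a residual projection is determined by its
values on the basis, the symbols are counted by a set built from `𝔽` and ℕ, in the universe of `κ`.
-/
theorem functionCode_injective (e : Module.Basis (Fin (n + 1)) 𝔽 𝒟) :
    Function.Injective (functionCode e) := by
  have hρ : ∀ ρ ρ' : 𝒟 →ₐ[𝔽] 𝔽, (fun i => ρ (e i)) = (fun i => ρ' (e i)) → ρ = ρ' := by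
    intro ρ ρ' h
    exact AlgHom.toLinearMap_injective (e.ext fun i => congrFun h i)
  rintro ⟨_, f⟩ ⟨_, g⟩ h
  cases f <;> cases g <;> simp only [functionCode, Sum.inl.injEq, Sum.inr.injEq, reduceCtorEq] at h
    <;> first
      | rfl
      | omega
      | (obtain rfl := h; rfl)
      | (obtain rfl := hρ _ _ h; rfl)
      | (obtain rfl := Fin.ext (Nat.add_left_cancel h); rfl)

theorem card_functionCode_lt (hS : O.SufficientlySaturated κ) :
    #(ℕ ⊕ 𝔽 ⊕ (Fin (n + 1) → 𝔽)) < κ := by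
  have hc : max ℵ₀ #𝔽 < κ := max_lt hS.aleph0_lt hS.base_lt
  have h1 : #(Fin (n + 1) → 𝔽) < κ := by
    refine lt_of_le_of_lt ?_ hc
    rw [Cardinal.mk_arrow, Cardinal.lift_uzero, Cardinal.mk_fin, Cardinal.lift_natCast,
      Cardinal.power_natCast]
    exact (pow_le_pow_left₀ (zero_le) (le_max_right ℵ₀ #𝔽) _).trans
      (Cardinal.power_nat_le (le_max_left _ _))
  simp only [Cardinal.mk_sum, Cardinal.lift_id, Cardinal.mk_nat, Cardinal.lift_aleph0,
    Cardinal.lift_uzero]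
  exact Cardinal.add_lt_of_lt hS.aleph0_lt.le hS.aleph0_lt
    (Cardinal.add_lt_of_lt hS.aleph0_lt.le hS.base_lt h1)

theorem card_closure_lt (hS : O.SufficientlySaturated κ) {A : Set K} (hA : #A < κ) :
    #(FirstOrder.Language.Substructure.closure O.lang A) < κ := by
  have h := FirstOrder.Language.Substructure.lift_card_closure_le (L := O.lang) (s := A)
  have h1 : Cardinal.lift.{u} #(Σ i, O.lang.Functions i) ≤
      Cardinal.lift.{max u v} #(ℕ ⊕ 𝔽 ⊕ (Fin (n + 1) → 𝔽)) :=
    Cardinal.lift_mk_le_lift_mk_of_injective (functionCode_injective e)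
  rw [← Cardinal.lift_lt.{u, max u v}]
  refine h.trans_lt (max_lt ?_ (Cardinal.add_lt_of_lt ?_ ?_ ?_))
  · simpa using hS.aleph0_lt
  · simpa using hS.aleph0_lt.le
  · simpa using hA
  · exact h1.trans_lt (Cardinal.lift_lt.2 (card_functionCode_lt hS))

theorem card_algIn_lt (hS : O.SufficientlySaturated κ) {A : Set K} (hA : #A < κ) :
    #(O.algIn A) < κ := by
  have h1 : #(O.gen A) < κ :=
    (Subfield.cardinalMk_closure_le_max _).trans_lt (max_lt (card_closure_lt hS hA) hS.aleph0_lt)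
  have h2 : (O.algIn A) = (algebraicClosure (O.gen A) K : Set K) := by
    ext x
    rw [O.mem_algIn]
    exact mem_algebraicClosure_iff.symm
  rw [h2]
  exact (Algebra.IsAlgebraic.cardinalMk_le_max (O.gen A) (algebraicClosure (O.gen A) K)).trans_lt
    (max_lt h1 hS.aleph0_lt)

theorem card_union_lt (hS : O.SufficientlySaturated κ) {A B : Set K} (hA : #A < κ) (hB : #B < κ) :
    #(A ∪ B : Set K) < κ :=
  (Cardinal.mk_union_le A B).trans_lt (Cardinal.add_lt_of_lt hS.aleph0_lt.le hA hB)

theorem card_lt_of_finite (hS : O.SufficientlySaturated κ) {A : Set K} (hA : A.Finite) : #A < κ :=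
  (Cardinal.lt_aleph0_iff_set_finite.2 hA).trans hS.aleph0_lt

theorem card_lt_of_subset {X : Type u} {A B : Set X} (h : A ⊆ B) (hB : #B < κ) : #A < κ :=
  (Cardinal.mk_le_mk_of_subset h).trans_lt hB

theorem card_lt_of_countable (hS : O.SufficientlySaturated κ) {A : Set K} (hA : A.Countable) :
    #A < κ :=
  (Cardinal.le_aleph0_iff_set_countable.2 hA).trans_lt hS.aleph0_lt

end Cardinality

end FieldOperators

namespace FieldOperators

variable {K : Type u} [Field K] {𝔽 : Subfield K} {n : ℕ} {𝒟 : Type v}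
  [CommRing 𝒟] [Algebra 𝔽 𝒟] {e : Module.Basis (Fin (n + 1)) 𝔽 𝒟} {O : FieldOperators 𝔽 e}
  {κ : Cardinal.{u}}

/-- The standing assumptions on the field `K` with operators. -/
structure Standing (O : FieldOperators 𝔽 e) (κ : Cardinal.{u}) : Prop where
  assoc : O.AssociatedBijective
  sat : O.SufficientlySaturated κ
  types : O.TypesDetermined
  simple : O.IndepSimple κ

/-! ### Changing the base of independence. -/

section IndepOverEmpty

theorem indep_empty_union {A B C : Set K} (h : O.Indep A ∅ C)
    (h' : O.Indep A C B) : O.Indep A ∅ (C ∪ B) :=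
  h.trans (by rwa [Set.empty_union])

theorem Indep.mono_right (hT : O.TypesDetermined) {A B C B' : Set K} (h : O.Indep A C B)
    (hB : B' ⊆ O.algIn (B ∪ C)) : O.Indep A C B' :=
  h.mono hT (subset_algIn_union_left _ _) hB

theorem Indep.mono_left (hT : O.TypesDetermined) {A B C A' : Set K} (h : O.Indep A C B)
    (hA : A' ⊆ O.algIn (A ∪ C)) : O.Indep A' C B :=
  h.mono hT hA (subset_algIn_union_left _ _)

theorem Indep.subset_right (hT : O.TypesDetermined) {A B C B' : Set K} (h : O.Indep A C B)
    (hB : B' ⊆ B) : O.Indep A C B' :=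
  h.mono_right hT (hB.trans (subset_algIn_union_left _ _))

theorem Indep.subset_left (hT : O.TypesDetermined) {A B C A' : Set K} (h : O.Indep A C B)
    (hA : A' ⊆ A) : O.Indep A' C B :=
  h.mono_left hT (hA.trans (subset_algIn_union_left _ _))

/-- Independence over `C'` from independence over a smaller set `C`. -/
theorem Indep.over (hE : O.AssociatedBijective) (hT : O.TypesDetermined) {A B C X C' : Set K}
    (h : O.Indep A C X) (hC : C ⊆ C') (hX : C' ⊆ X) (hB : B ⊆ X) : O.Indep A C' B :=
  (h.base_mono hE hT hC (hX.trans (subset_algIn_union_left _ _))).subset_right hT hB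

theorem Indep.union_left {A B C A' : Set K} (h : O.Indep A C B)
    (h' : O.Indep A' (C ∪ A) B) : O.Indep (A ∪ A') C B :=
  (h.symm.trans h'.symm).symm

theorem mem_algIn_of_mem {A : Set K} {x : K} (h : x ∈ A) : x ∈ O.algIn A := O.subset_algIn A h

theorem add_mem_algIn {A : Set K} {x y : K} (hx : x ∈ O.algIn A) (hy : y ∈ O.algIn A) :
    x + y ∈ O.algIn A := (O.algField A).add_mem hx hy

theorem sub_mem_algIn {A : Set K} {x y : K} (hx : x ∈ O.algIn A) (hy : y ∈ O.algIn A) :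
    x - y ∈ O.algIn A := (O.algField A).sub_mem hx hy

theorem mul_mem_algIn {A : Set K} {x y : K} (hx : x ∈ O.algIn A) (hy : y ∈ O.algIn A) :
    x * y ∈ O.algIn A := (O.algField A).mul_mem hx hy

theorem neg_mem_algIn {A : Set K} {x : K} (hx : x ∈ O.algIn A) :
    -x ∈ O.algIn A := (O.algField A).neg_mem hx

theorem inv_mem_algIn {A : Set K} {x : K} (hx : x ∈ O.algIn A) :
    x⁻¹ ∈ O.algIn A := (O.algField A).inv_mem hx

theorem zero_mem_algIn {A : Set K} : (0 : K) ∈ O.algIn A := (O.algField A).zero_mem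

end IndepOverEmpty

/-! ### Generic elements of the additive group, and their products. -/

section Generics

/-- One-element form of the extension axiom. -/
theorem Standing.exists_aut_indep (H : O.Standing κ) {m : ℕ} (a : Fin m → K) {C B : Set K}
    (hC : C ⊆ B) (hB : #B < κ) :
    ∃ f : K ≃[O.lang] K, (∀ x ∈ C, f x = x) ∧ O.Indep (Set.range fun i => f (a i)) C B := by
  obtain ⟨a', ha', hi⟩ := H.simple.extension m a C B hC hB
  obtain ⟨f, hf, hfa⟩ := ha'.symm.exists_aut H.sat (card_lt_of_subset hC hB)
  refine ⟨f, hf, ?_⟩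
  rwa [funext hfa]

theorem Standing.exists_aut_indep_singleton (H : O.Standing κ) (a : K) {C B : Set K}
    (hC : C ⊆ B) (hB : #B < κ) :
    ∃ f : K ≃[O.lang] K, (∀ x ∈ C, f x = x) ∧ O.Indep {f a} C B := by
  obtain ⟨f, hf, hi⟩ := H.exists_aut_indep (fun _ : Fin 1 => a) hC hB
  exact ⟨f, hf, by rwa [Set.range_const] at hi⟩

theorem Generic.indep_empty (hT : O.TypesDetermined) {g : K} {A : Set K} (h : O.Generic g A) :
    O.Indep {g} ∅ A := by
  have := h 0 (indep_of_subset_algIn hT (by simpa using zero_mem_algIn))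
  rw [zero_add] at this
  exact this.subset_right hT Set.subset_union_left

/-- With `Generic.indep_empty` and `Generic.empty`, genericity over a small set becomes genericity
over ∅ plus independence from that set. Here `l + g` is independent of `l` by genericity over ∅, and
of `A` over `l` because it is interalgebraic with `g` over `l`. -/
theorem generic_of_indep_empty (H : O.Standing κ) {g : K} {A : Set K} (h : O.Generic g ∅)
    (hA : O.Indep {g} ∅ A) : O.Generic g A := by
  intro l hl
  have h1 := indep_empty_union hA hl
  have h2 := h l (h1.subset_right H.types Set.subset_union_right)
  rw [Set.empty_union] at h2
  have h3 : O.Indep {g} {l} A :=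
    h1.over H.assoc H.types (Set.empty_subset _) Set.subset_union_right Set.subset_union_left
  have h4 : O.Indep {l + g} {l} A := h3.mono_left H.types (by
    rw [Set.singleton_subset_iff]
    exact add_mem_algIn (mem_algIn_of_mem (by simp)) (mem_algIn_of_mem (by simp)))
  rw [Set.union_comm]
  exact indep_empty_union h2 h4

/-- Translating a generic by a parameter. -/
theorem Generic.add_indep (H : O.Standing κ) {g : K} {A : Set K} (h : O.Generic g ∅)
    (hA : O.Indep {g} ∅ A) {l : K} (hl : l ∈ O.algIn A) : O.Indep {l + g} ∅ A :=
  (generic_of_indep_empty H h hA l (indep_of_subset_algIn H.types (by simpa using hl))).subset_right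
    H.types Set.subset_union_left

theorem Indep.aut_singleton (H : O.Standing κ) (f : K ≃[O.lang] K) {a b : K}
    (h : O.Indep {a} ∅ {b}) : O.Indep {f a} ∅ {f b} := by
  have := h.map H.assoc f
  simpa using this

/-- The test element `l` may depend on `A`. An automorphism fixing `g` moves it to a conjugate
independent of `A` over `g`; genericity over `A` applies to the conjugate, and the result is pulled
back. -/
theorem Generic.empty (H : O.Standing κ) {g : K} {A : Set K} (hA : #A < κ) (h : O.Generic g A) :
    O.Generic g ∅ := by
  intro l hl
  rw [Set.empty_union]
  have hcard : #({g} ∪ A : Set K) < κ :=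
    card_union_lt H.sat (card_lt_of_finite H.sat (Set.finite_singleton g)) hA
  obtain ⟨f, hf, hi⟩ := H.exists_aut_indep_singleton l (C := {g}) Set.subset_union_left hcard
  have hfg : f g = g := hf g rfl
  have h1 : O.Indep {g} ∅ {f l} := by simpa [hfg] using hl.aut_singleton H f
  have h2 : O.Indep A ∅ ({g} ∪ {f l}) := indep_empty_union (h.indep_empty H.types).symm
    (hi.subset_right H.types Set.subset_union_right).symm
  have h3 : O.Indep {g} {f l} A := (h2.over H.assoc H.types (Set.empty_subset _)
    Set.subset_union_right Set.subset_union_left).symm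
  have h4 := (indep_empty_union h1 h3)
  have h5 := h (f l) (h4.over H.assoc H.types (Set.empty_subset _) Set.subset_union_right
    Set.subset_union_left)
  have h6 := (h5.subset_right H.types Set.subset_union_right).aut_singleton H f.symm
  have h7 : f.symm (f l + g) = l + g := by
    rw [aut_add, f.symm_apply_apply]
    conv_lhs => rw [← hfg, f.symm_apply_apply]
  rwa [h7, f.symm_apply_apply] at h6

theorem Generic.aut (H : O.Standing κ) (f : K ≃[O.lang] K) {g : K} (h : O.Generic g ∅) :
    O.Generic (f g) ∅ := by
  intro l hl
  rw [Set.empty_union]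
  have h1 := hl.aut_singleton H f.symm
  rw [f.symm_apply_apply] at h1
  have h2 := h _ h1
  rw [Set.empty_union] at h2
  have h3 := h2.aut_singleton H f
  rwa [aut_add, f.apply_symm_apply] at h3

theorem Generic.neg (H : O.Standing κ) {g : K} (h : O.Generic g ∅) : O.Generic (-g) ∅ := by
  intro l hl
  rw [Set.empty_union]
  have hneg : ∀ {x : K} {A : Set K}, x ∈ A → ({-x} : Set K) ⊆ O.algIn A := fun hx =>
    Set.singleton_subset_iff.2 (neg_mem_algIn (mem_algIn_of_mem hx))
  have h1 : O.Indep {g} ∅ {-l} := by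
    have := hl.mono H.types (A' := {- -g}) (B' := {-l}) (hneg (by simp)) (hneg (by simp))
    rwa [neg_neg] at this
  have h2 := h _ h1
  have := h2.mono H.types (A' := {-(-l + g)}) (B' := {- -l}) (hneg (by simp)) (hneg (by simp))
  rwa [neg_neg, neg_add, neg_neg] at this

/-- Replace the test element `m` by a conjugate over `l + g` that is independent of `g, l`. Then `g`
is independent of `l` and the conjugate together, and translating `g` by their sum gives the claim.
-/
theorem Generic.add (H : O.Standing κ) {g l : K} (h : O.Generic g ∅) (hl : O.Indep {g} ∅ {l}) :
    O.Generic (l + g) ∅ := by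
  intro m hm
  rw [Set.empty_union]
  obtain ⟨f, hf, hi⟩ := H.exists_aut_indep_singleton m (C := {l + g}) (B := {l + g, g, l})
    (by simp) (card_lt_of_finite H.sat (by simp))
  have hfg : f (l + g) = l + g := hf _ rfl
  have h1 : O.Indep {f m} ∅ {l + g} := by
    have := (hm.aut_singleton H f).symm
    rwa [hfg] at this
  have h2 := indep_empty_union h1 hi
  have h3 : O.Indep {g} {l} {f m} := (h2.over H.assoc H.types (C' := {l}) (B := {g})
    (Set.empty_subset _) (by simp) (by simp)).symm
  have h4 := indep_empty_union hl h3
  have h5 := (h.add_indep H h4 (l := f m + l)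
    (add_mem_algIn (mem_algIn_of_mem (by simp)) (mem_algIn_of_mem (by simp))))
  have h6 := (h5.subset_right H.types Set.subset_union_right).aut_singleton H f.symm
  have h7 : f.symm (f m + l + g) = m + (l + g) := by
    rw [add_assoc, aut_add, f.symm_apply_apply]
    conv_lhs => rw [← hfg, f.symm_apply_apply]
  rwa [h7, f.symm_apply_apply] at h6

/-- A realization of the type of `g` that is independent of a given set. -/
theorem Standing.exists_aut_indep_empty (H : O.Standing κ) (g : K) {A : Set K} (hA : #A < κ) :
    ∃ f : K ≃[O.lang] K, O.Indep {f g} ∅ A := by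
  obtain ⟨f, -, hf⟩ := H.exists_aut_indep_singleton g (Set.empty_subset A) hA
  exact ⟨f, hf⟩

/-- Let `c` be a conjugate of `b` independent of everything in sight. As a translate of `c`, the
element ab + c is generic and independent of `A`. As a(a⁻¹c + b), a multiple of a translate of `b`,
it is independent of `c` over `A`. Subtracting `c` is then a translation by an independent element,
and leaves ab generic and independent of `A`. -/
theorem Generic.mul (H : O.Standing κ) {b a : K} {A : Set K} (hb : O.Generic b ∅)
    (hbA : O.Indep {b} ∅ A) (hA : #A < κ) (ha : a ∈ A) (ha0 : a ≠ 0) :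
    O.Generic (a * b) ∅ ∧ O.Indep {a * b} ∅ A := by
  have hcard : #(A ∪ {b} : Set K) < κ :=
    card_union_lt H.sat hA (card_lt_of_finite H.sat (Set.finite_singleton b))
  obtain ⟨f, hf⟩ := H.exists_aut_indep_empty b hcard
  set c := f b
  have hc : O.Generic c ∅ := hb.aut H f
  have hab : a * b ∈ O.algIn (A ∪ {b}) :=
    mul_mem_algIn (mem_algIn_of_mem (Or.inl ha)) (mem_algIn_of_mem (Or.inr rfl))
  have hab' : ({a * b} : Set K) ⊆ O.algIn (A ∪ {b} ∪ ∅) := by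
    rw [Set.union_empty]
    exact Set.singleton_subset_iff.2 hab
  have hce : O.Generic (a * b + c) ∅ := hc.add H (hf.mono_right H.types hab')
  have heA : O.Indep {a * b + c} ∅ A :=
    (hc.add_indep H hf hab).subset_right H.types Set.subset_union_left
  have hbAc : O.Indep {b} ∅ (A ∪ {c}) := by
    refine indep_empty_union hbA ?_
    exact (hf.over H.assoc H.types (Set.empty_subset _) Set.subset_union_left
      Set.subset_union_right).symm
  have h1 : O.Indep {a⁻¹ * c + b} ∅ (A ∪ {c}) := hb.add_indep H hbAc
    (mul_mem_algIn (inv_mem_algIn (mem_algIn_of_mem (Or.inl ha))) (mem_algIn_of_mem (Or.inr rfl)))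
  have h2 : O.Indep {a * b + c} A {c} := by
    refine (h1.over H.assoc H.types (C' := A) (Set.empty_subset _) Set.subset_union_left
      Set.subset_union_right).mono_left H.types (Set.singleton_subset_iff.2 ?_)
    have : a * b + c = a * (a⁻¹ * c + b) := by field_simp; ring
    rw [this]
    exact mul_mem_algIn (mem_algIn_of_mem (Or.inr ha)) (mem_algIn_of_mem (Or.inl rfl))
  have h3 : O.Indep {a * b + c} ∅ (A ∪ {c}) := indep_empty_union heA h2
  have h4 : -c + (a * b + c) = a * b := by ring
  have hcm : -c ∈ O.algIn (A ∪ {c}) := neg_mem_algIn (mem_algIn_of_mem (Or.inr rfl))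
  constructor
  · have := hce.add H (l := -c) (h3.mono_right H.types (by
      rw [Set.union_empty]
      exact Set.singleton_subset_iff.2 hcm))
    rwa [h4] at this
  · have := (hce.add_indep H h3 hcm).subset_right H.types (Set.subset_union_left)
    rwa [h4] at this

end Generics

/-! ### The closure cl and dropping parameters from it. -/

section Closure

variable {g : K}

/-- The definition tests only realizations of p. Given a generic b, choose a realization d of p
independent of `D₁`, b and x, and put w = b - d. Over `D₁ ∪ {w}` the elements b and d are
interalgebraic and d is generic, so the definition applies to d; as w is independent of x over `D₁`,
transitivity removes it. -/
theorem mem_cl_iff (H : O.Standing κ) (hg : O.Generic g ∅) {D : Set K} {x : K} :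
    x ∈ O.cl κ g D ↔ ∀ D₁, D ⊆ D₁ → #D₁ < κ → ∀ c, O.Generic c ∅ → O.Indep {c} ∅ D₁ →
      O.Indep {c} ∅ (D₁ ∪ {x}) := by
  constructor
  · intro hx D₁ hD hD₁ b hb hbD
    have hfin : ∀ y : K, #({y} : Set K) < κ := fun y =>
      card_lt_of_finite H.sat (Set.finite_singleton y)
    have hcard : #(D₁ ∪ {b} ∪ {x} : Set K) < κ :=
      card_union_lt H.sat (card_union_lt H.sat hD₁ (hfin b)) (hfin x)
    obtain ⟨f, hf⟩ := H.exists_aut_indep_empty g hcard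
    set d := f g with hd
    have hdg : O.Generic d ∅ := hg.aut H f
    have hdn : O.Indep {-d} ∅ (D₁ ∪ {b} ∪ {x}) := hf.mono_left H.types
      (Set.singleton_subset_iff.2 (neg_mem_algIn (mem_algIn_of_mem (by simp))))
    have hw : O.Indep {b + -d} ∅ (D₁ ∪ {b} ∪ {x}) :=
      (hdg.neg H).add_indep H hdn (mem_algIn_of_mem (by simp))
    set w := b + -d with hwd
    have hbw : O.Indep {b} ∅ (D₁ ∪ {w}) := indep_empty_union hbD
      (hw.over H.assoc H.types (Set.empty_subset _)
        (Set.subset_union_left.trans Set.subset_union_left)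
        (Set.subset_union_right.trans Set.subset_union_left)).symm
    have hdw : O.Indep {d} ∅ (D₁ ∪ {w}) := by
      have := hb.add_indep H hbw (l := -w) (neg_mem_algIn (mem_algIn_of_mem (by simp)))
      rwa [show -w + b = d by rw [hwd]; ring] at this
    have hgen : O.Generic d (D₁ ∪ {w}) := generic_of_indep_empty H hdg hdw
    have h1 : O.Indep {d} (D₁ ∪ {w}) {x} := hx (D₁ ∪ {w}) (hD.trans Set.subset_union_left)
      (card_union_lt H.sat hD₁ (hfin w)) d
      (sameType_of_aut f (fun x hx => hx.elim) (fun _ => rfl)).symm hgen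
    have h2 : O.Indep {b} (D₁ ∪ {w}) {x} := h1.mono_left H.types (by
      rw [Set.singleton_subset_iff, show b = w + d by rw [hwd]; ring]
      exact add_mem_algIn (mem_algIn_of_mem (by simp)) (mem_algIn_of_mem (by simp)))
    have h3 : O.Indep {x} D₁ {w} := (hw.over H.assoc H.types (Set.empty_subset _)
      (Set.subset_union_left.trans Set.subset_union_left) Set.subset_union_right).symm
    have h4 : O.Indep {x} D₁ ({w} ∪ {b}) := h3.trans h2.symm
    exact indep_empty_union hbD (h4.subset_right H.types Set.subset_union_right).symm
  · intro h D₁ hD hD₁ a ha hgen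
    obtain ⟨f, -, hf⟩ := ha.symm.exists_aut H.sat (by
      rw [Cardinal.mk_eq_zero]; exact lt_trans Cardinal.aleph0_pos H.sat.aleph0_lt)
    have hfa : f g = a := hf 0
    have hag : O.Generic a ∅ := hfa ▸ hg.aut H f
    exact (h D₁ hD hD₁ a hag (hgen.indep_empty H.types)).over H.assoc H.types
      (Set.empty_subset _) Set.subset_union_left Set.subset_union_right

theorem cl_mono {D D' : Set K} (h : D ⊆ D') : O.cl κ g D ⊆ O.cl κ g D' :=
  fun _ hx D₁ hD => hx D₁ (h.trans hD)

/-- Elements of `E` are added one at a time, each time absorbed into the small parameter set. Finite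
character then handles an `E` that need not be small. -/
theorem indep_union_of_subset_cl (H : O.Standing κ) (hg : O.Generic g ∅) {D D₁ E : Set K}
    (hD : D ⊆ D₁) (hD₁ : #D₁ < κ) (hE : E ⊆ O.cl κ g D) {c : K} (hc : O.Generic c ∅)
    (hcD : O.Indep {c} ∅ D₁) : O.Indep {c} ∅ (D₁ ∪ E) := by
  have hfin : ∀ E₀ : Set K, E₀.Finite → E₀ ⊆ E → O.Indep {c} ∅ (D₁ ∪ E₀) := by
    intro E₀ hfin
    induction E₀, hfin using Set.Finite.induction_on with
    | empty => intro _; rwa [Set.union_empty]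
    | @insert x S _ hS ih =>
      intro hsub
      have h1 := ih ((Set.subset_insert _ _).trans hsub)
      have h2 := (mem_cl_iff H hg).1 (hE (hsub (Set.mem_insert _ _))) (D₁ ∪ S)
        (hD.trans Set.subset_union_left)
        (card_union_lt H.sat hD₁ (card_lt_of_finite H.sat hS)) c hc h1
      rwa [Set.union_assoc, Set.union_comm S, ← Set.insert_eq] at h2
  refine Indep.symm (indep_of_forall_finite H.types fun A₀ hA₀ hA₀f => ?_)
  have h1 := (hfin (A₀ ∩ E) (hA₀f.subset Set.inter_subset_left) Set.inter_subset_right).symm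
  refine h1.subset_left H.types fun x hx => ?_
  rcases hA₀ hx with h | h
  · exact Or.inl h
  · exact Or.inr ⟨hx, h⟩

/-- `cl` is a closure operator that contains algebraic closure. -/
theorem algIn_subset_cl (H : O.Standing κ) (hg : O.Generic g ∅) {D E : Set K}
    (hE : E ⊆ O.cl κ g D) : O.algIn E ⊆ O.cl κ g D := by
  intro x hx
  rw [mem_cl_iff H hg]
  intro D₁ hD hD₁ c hc hcD
  refine (indep_union_of_subset_cl H hg hD hD₁ hE hc hcD).mono_right H.types ?_
  rw [Set.union_empty]
  refine Set.union_subset (subset_algIn_union_left _ _) (Set.singleton_subset_iff.2 ?_)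
  exact O.algIn_mono Set.subset_union_right hx

theorem subset_cl (H : O.Standing κ) (D : Set K) : D ⊆ O.cl κ g D := by
  intro x hx D₁ hD _ a _ _
  exact indep_of_subset_algIn H.types (Set.singleton_subset_iff.2 (mem_algIn_of_mem (hD hx)))

theorem cl_aut (H : O.Standing κ) (hg : O.Generic g ∅) (f : K ≃[O.lang] K) {D : Set K} {x : K}
    (hx : x ∈ O.cl κ g D) : f x ∈ O.cl κ g (f '' D) := by
  rw [mem_cl_iff H hg] at hx ⊢
  intro D₁ hD hD₁ c hc hcD
  have hsub : D ⊆ f.symm '' D₁ := by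
    rw [← symm_image_image f D]
    exact Set.image_mono hD
  have h1 := hx (f.symm '' D₁) hsub (Cardinal.mk_image_le.trans_lt hD₁) (f.symm c)
    (hc.aut H f.symm) (by simpa using hcD.map H.assoc f.symm)
  have h2 := h1.map H.assoc f
  have h3 : f '' (f.symm '' D₁) = D₁ := symm_image_image f.symm D₁
  rw [Set.image_union, h3] at h2
  simpa using h2

/-- Descent of `cl` along an independent set of parameters. -/
theorem mem_cl_of_indep (H : O.Standing κ) (hg : O.Generic g ∅) {D B : Set K} (hB : B.Finite)
    (hD : #D < κ) {x : K} (hx : x ∈ O.cl κ g (D ∪ B)) (hi : O.Indep {x} D B) :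
    x ∈ O.cl κ g D := by
  rw [mem_cl_iff H hg]
  intro D₁ hDD hD₁ c hc hcD
  have hfin : ∀ y : K, #({y} : Set K) < κ := fun y =>
    card_lt_of_finite H.sat (Set.finite_singleton y)
  have := hB.fintype
  let eB := Fintype.equivFin B
  -- Conjugating over `D ∪ {x}` makes `B` independent of `D₁` and `c` while `x` stays in the closure
  -- of `D` and the conjugate. That conjugate can then join `D₁` as parameters without disturbing
  -- the independence of `c`.
  obtain ⟨f, hf, hfi⟩ := H.exists_aut_indep (fun i => (eB.symm i : K)) (C := D ∪ {x})
    (B := D ∪ {x} ∪ (D₁ ∪ {c})) Set.subset_union_left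
    (card_union_lt H.sat (card_union_lt H.sat hD (hfin x)) (card_union_lt H.sat hD₁ (hfin c)))
  have hrange : (Set.range fun i => f (eB.symm i : K)) = f '' B := by
    ext y
    constructor
    · rintro ⟨i, rfl⟩
      exact ⟨_, (eB.symm i).2, rfl⟩
    · rintro ⟨z, hz, rfl⟩
      exact ⟨eB ⟨z, hz⟩, by simp⟩
  rw [hrange] at hfi
  have hfx : f x = x := hf x (Or.inr rfl)
  have hfD : f '' D = D := by
    refine (Set.image_congr fun y hy => hf y (Or.inl hy)).trans (Set.image_id' D)
  have hx' : x ∈ O.cl κ g (D ∪ f '' B) := by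
    have := cl_aut H hg f hx
    rwa [hfx, Set.image_union, hfD] at this
  have hi' : O.Indep {x} D (f '' B) := by
    have := hi.map H.assoc f
    rwa [Set.image_singleton, hfx, hfD] at this
  have h1 : O.Indep (f '' B) D ({x} ∪ (D ∪ {x} ∪ (D₁ ∪ {c}))) := hi'.symm.trans hfi
  have h2 : O.Indep {c} D₁ (f '' B) := by
    refine Indep.symm (h1.over H.assoc H.types hDD ?_ ?_)
    · exact fun y hy => Or.inr (Or.inr (Or.inl hy))
    · simp
  have h3 := indep_empty_union hcD h2
  have h4 := (mem_cl_iff H hg).1 hx' (D₁ ∪ f '' B) (Set.union_subset_union_left _ hDD)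
    (card_union_lt H.sat hD₁ (card_lt_of_finite H.sat (hB.image f))) c hc h3
  refine h4.subset_right H.types ?_
  rintro y (hy | hy)
  · exact Or.inl (Or.inl hy)
  · exact Or.inr hy

end Closure

end FieldOperators

namespace FieldOperators

variable {K : Type u} [Field K] {𝔽 : Subfield K} {n : ℕ} {𝒟 : Type v}
  [CommRing 𝒟] [Algebra 𝔽 𝒟] {e : Module.Basis (Fin (n + 1)) 𝔽 𝒟} {O : FieldOperators 𝔽 e}
  {κ : Cardinal.{u}}

/-! ### Saturation for tuples and ultrafilter averages. -/

section Types

theorem sameType_iff_definable {A : Set K} {ι : Type*} {a b : ι → K} :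
    O.SameType A a b ↔ ∀ X : Set (ι → K), A.Definable O.lang X → (a ∈ X ↔ b ∈ X) := by
  constructor
  · rintro h X ⟨φ, rfl⟩
    exact h φ
  · intro h φ
    exact h _ ⟨φ, rfl⟩

/-- Substituting parameters for some of the variables of a definable set. -/
theorem definable_subst {A A' : Set K} (hA : A ⊆ A') {α γ : Type*} {X : Set (γ → K)}
    (hX : A.Definable O.lang X) (h : γ → α ⊕ A') {f : (α → K) → γ → K}
    (hf : ∀ x c, f x c = Sum.elim x (↑) (h c)) :
    A'.Definable O.lang {x : α → K | f x ∈ X} := by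
  obtain rfl : f = fun x c => Sum.elim x (↑) (h c) := funext fun x => funext (hf x)
  rw [Set.definable_iff_exists_formula_sum] at hX ⊢
  obtain ⟨φ, rfl⟩ := hX
  refine ⟨φ.relabel (Sum.elim (fun a => Sum.inl (Set.inclusion hA a)) fun c => (h c).swap), ?_⟩
  ext x
  simp only [Set.mem_ofPred_eq, FirstOrder.Language.Formula.realize_relabel]
  have : (Sum.elim (↑) (fun c => Sum.elim x (↑) (h c)) : A ⊕ γ → K) =
      Sum.elim (↑) x ∘ Sum.elim (fun a => Sum.inl (Set.inclusion hA a)) fun c => (h c).swap := by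
    ext i
    rcases i with i | i
    · rfl
    · simp only [Sum.elim_inr, Function.comp_apply]
      rcases h i with j | j <;> rfl
  rw [this]

theorem SufficientlySaturated.exists_mem_one (hS : O.SufficientlySaturated κ) {A : Set K}
    (hA : #A < κ) (𝒮 : Set (Set (Fin 1 → K))) (hdef : ∀ X ∈ 𝒮, A.Definable O.lang X)
    (hdir : ∀ X ∈ 𝒮, ∀ Y ∈ 𝒮, ∃ Z ∈ 𝒮, Z ⊆ X ∩ Y) (hne : ∀ X ∈ 𝒮, X.Nonempty) :
    ∃ x : K, ∀ X ∈ 𝒮, (fun _ => x) ∈ X := by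
  rcases 𝒮.eq_empty_or_nonempty with rfl | ⟨X₀, hX₀⟩
  · exact ⟨0, fun X hX => hX.elim⟩
  obtain ⟨x, hx⟩ := hS.saturated A hA {φ | Set.ofPred φ.Realize ∈ 𝒮} (by
    intro q hq hfin
    have key : ∃ Z ∈ 𝒮, ∀ φ ∈ q, ∀ z ∈ Z, φ.Realize z := by
      induction q, hfin using Set.Finite.induction_on with
      | empty => exact ⟨X₀, hX₀, by simp⟩
      | @insert φ q _ _ ih =>
        obtain ⟨Z, hZ, hZq⟩ := ih ((Set.subset_insert _ _).trans hq)
        obtain ⟨Z', hZ', hsub⟩ := hdir Z hZ _ (hq (Set.mem_insert φ q))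
        refine ⟨Z', hZ', ?_⟩
        rintro ψ (rfl | hψ) z hz
        · exact (hsub hz).2
        · exact hZq ψ hψ z (hsub hz).1
    obtain ⟨Z, hZ, hZq⟩ := key
    obtain ⟨z, hz⟩ := hne Z hZ
    refine ⟨z 0, fun φ hφ => ?_⟩
    have : (fun _ => z 0) = z := by ext i; rw [Subsingleton.elim i 0]
    rw [this]
    exact hZq φ hφ z hz)
  refine ⟨x, fun X hX => ?_⟩
  obtain ⟨φ, rfl⟩ := hdef X hX
  exact hx φ hX

/-- A directed family of nonempty definable sets of tuples has a common point. -/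
theorem SufficientlySaturated.exists_mem (hS : O.SufficientlySaturated κ) (m : ℕ) :
    ∀ {A : Set K}, #A < κ → ∀ 𝒮 : Set (Set (Fin m → K)),
    (∀ X ∈ 𝒮, A.Definable O.lang X) → (∀ X ∈ 𝒮, ∀ Y ∈ 𝒮, ∃ Z ∈ 𝒮, Z ⊆ X ∩ Y) →
    (∀ X ∈ 𝒮, X.Nonempty) → ∃ x, ∀ X ∈ 𝒮, x ∈ X := by
  induction m with
  | zero =>
    intro A _ 𝒮 _ _ hne
    refine ⟨Fin.elim0, fun X hX => ?_⟩
    obtain ⟨x, hx⟩ := hne X hX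
    rwa [Subsingleton.elim Fin.elim0 x]
  | succ m ih =>
    intro A hA 𝒮 hdef hdir hne
    -- Saturation is given for one variable: realize the projections to the first `m` coordinates,
    -- then find the last coordinate in the fibres above that point.
    obtain ⟨y, hy⟩ := ih hA
      ((fun X => (fun x : Fin (m + 1) → K => x ∘ Fin.castSucc) '' X) '' 𝒮)
      (by
        rintro _ ⟨X, hX, rfl⟩
        exact (hdef X hX).image_comp Fin.castSucc)
      (by
        rintro _ ⟨X, hX, rfl⟩ _ ⟨Y, hY, rfl⟩
        obtain ⟨Z, hZ, hsub⟩ := hdir X hX Y hY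
        exact ⟨_, ⟨Z, hZ, rfl⟩, Set.subset_inter
          (Set.image_mono (hsub.trans Set.inter_subset_left))
          (Set.image_mono (hsub.trans Set.inter_subset_right))⟩)
      (by
        rintro _ ⟨X, hX, rfl⟩
        exact (hne X hX).image _)
    have hA' : #(A ∪ Set.range y : Set K) < κ :=
      card_union_lt hS hA (card_lt_of_finite hS (Set.finite_range y))
    obtain ⟨z, hz⟩ := hS.exists_mem_one hA'
      ((fun X : Set (Fin (m + 1) → K) =>
        {z : Fin 1 → K | (Fin.snoc y (z 0) : Fin (m + 1) → K) ∈ X}) '' 𝒮)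
      (by
        rintro _ ⟨X, hX, rfl⟩
        refine definable_subst (A' := A ∪ Set.range y) Set.subset_union_left (hdef X hX)
          (Fin.snoc (fun i : Fin m => Sum.inr ⟨y i, Or.inr ⟨i, rfl⟩⟩) (Sum.inl (0 : Fin 1)) :
            Fin (m + 1) → Fin 1 ⊕ (A ∪ Set.range y : Set K)) fun z i => ?_
        refine Fin.lastCases ?_ (fun i => ?_) i <;> simp)
      (by
        rintro _ ⟨X, hX, rfl⟩ _ ⟨Y, hY, rfl⟩
        obtain ⟨Z, hZ, hsub⟩ := hdir X hX Y hY
        exact ⟨_, ⟨Z, hZ, rfl⟩, fun z hz => ⟨(hsub hz).1, (hsub hz).2⟩⟩)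
      (by
        rintro _ ⟨X, hX, rfl⟩
        obtain ⟨x, hx, hxy⟩ := hy _ ⟨X, hX, rfl⟩
        refine ⟨fun _ => x (Fin.last m), ?_⟩
        have : (Fin.snoc y (x (Fin.last m)) : Fin (m + 1) → K) = x := by
          rw [← hxy]
          exact Fin.snoc_init_self x
        change Fin.snoc y (x (Fin.last m)) ∈ X
        rwa [this])
    exact ⟨Fin.snoc y z, fun X hX => hz _ ⟨X, hX, rfl⟩⟩

/-- `x` realizes over `A` the average of the sequence `a` along the ultrafilter `U`. -/
def RealizesAverage (O : FieldOperators 𝔽 e) (U : Ultrafilter ℕ) {m : ℕ} (a : ℕ → Fin m → K)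
    (A : Set K) (x : Fin m → K) : Prop :=
  ∀ X : Set (Fin m → K), A.Definable O.lang X → (x ∈ X ↔ ∀ᶠ i in (U : Filter ℕ), a i ∈ X)

theorem exists_realizesAverage (hS : O.SufficientlySaturated κ) (U : Ultrafilter ℕ) {m : ℕ}
    (a : ℕ → Fin m → K) {A : Set K} (hA : #A < κ) : ∃ x, O.RealizesAverage U a A x := by
  obtain ⟨x, hx⟩ := hS.exists_mem m hA
    {X | A.Definable O.lang X ∧ ∀ᶠ i in (U : Filter ℕ), a i ∈ X} (fun X hX => hX.1)
    (fun X hX Y hY => ⟨X ∩ Y, ⟨hX.1.inter hY.1, hX.2.and hY.2⟩, subset_rfl⟩)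
    (fun X hX => let ⟨i, hi⟩ := hX.2.exists; ⟨a i, hi⟩)
  refine ⟨x, fun X hX => ⟨fun hxX => ?_, fun h => hx X ⟨hX, h⟩⟩⟩
  by_contra hn
  rw [← Ultrafilter.eventually_not] at hn
  exact hx Xᶜ ⟨hX.compl, hn⟩ hxX

theorem RealizesAverage.mono {U : Ultrafilter ℕ} {m : ℕ} {a : ℕ → Fin m → K} {A A' : Set K}
    {x : Fin m → K} (h : O.RealizesAverage U a A x) (hA : A' ⊆ A) : O.RealizesAverage U a A' x :=
  fun X hX => h X (hX.mono hA)

/-- Recursive construction of a sequence, each term being chosen over the previous ones. -/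
theorem exists_sequence (hS : O.SufficientlySaturated κ) {m : ℕ}
    (P : Set K → (Fin m → K) → Prop) (hP : ∀ T : Set K, #T < κ → ∃ x, P T x) {A : Set K}
    (hA : #A < κ) : ∃ s : ℕ → Fin m → K, ∀ i, P (A ∪ ⋃ j < i, Set.range (s j)) (s i) := by
  classical
  -- Choice is made total with the dummy value 0 on large sets; the recursion only ever meets small
  -- ones.
  have hP' : ∀ T : Set K, ∃ x, #T < κ → P T x := fun T => by
    by_cases hT : #T < κ
    · obtain ⟨x, hx⟩ := hP T hT
      exact ⟨x, fun _ => hx⟩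
    · exact ⟨0, fun h => (hT h).elim⟩
  choose F hF using hP'
  let T : ℕ → Set K := fun i => Nat.rec A (fun _ T => T ∪ Set.range (F T)) i
  have hTs : ∀ i, T (i + 1) = T i ∪ Set.range (F (T i)) := fun i => rfl
  have hT : ∀ i, T i = A ∪ ⋃ j < i, Set.range (F (T j)) := by
    intro i
    induction i with
    | zero => simp [T]
    | succ i ih =>
      rw [hTs, Set.biUnion_lt_succ, ← Set.union_assoc, ← ih]
  have hcard : ∀ i, #(↥(T i)) < κ := by
    intro i
    induction i with
    | zero => exact hA
    | succ i ih =>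
      rw [hTs]
      exact card_union_lt hS ih (card_lt_of_finite hS (Set.finite_range _))
  exact ⟨fun i => F (T i), fun i => hT i ▸ hF (T i) (hcard i)⟩

end Types

/-! ### Dependence is witnessed by a definable set. -/

section Dependence

/-- The term functions with parameters in `A`. -/
def IsTermFunction (O : FieldOperators 𝔽 e) (A : Set K) {α : Type*} (h : (α → K) → K) : Prop :=
  ∃ τ : O.lang.Term (A ⊕ α), ∀ x, h x = τ.realize (Sum.elim (↑) x)

theorem IsTermFunction.add {A : Set K} {α : Type*} {h h' : (α → K) → K}
    (H : O.IsTermFunction A h) (H' : O.IsTermFunction A h') :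
    O.IsTermFunction A (fun x => h x + h' x) := by
  obtain ⟨τ, hτ⟩ := H
  obtain ⟨τ', hτ'⟩ := H'
  refine ⟨FirstOrder.Language.Term.func (OpFunctions.add : OpFunctions 𝔽 n 𝒟 2) ![τ, τ'], ?_⟩
  intro x
  exact (congrArg₂ (· + ·) (hτ x) (hτ' x)).trans rfl

theorem IsTermFunction.mul {A : Set K} {α : Type*} {h h' : (α → K) → K}
    (H : O.IsTermFunction A h) (H' : O.IsTermFunction A h') :
    O.IsTermFunction A (fun x => h x * h' x) := by
  obtain ⟨τ, hτ⟩ := H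
  obtain ⟨τ', hτ'⟩ := H'
  refine ⟨FirstOrder.Language.Term.func (OpFunctions.mul : OpFunctions 𝔽 n 𝒟 2) ![τ, τ'], ?_⟩
  intro x
  exact (congrArg₂ (· * ·) (hτ x) (hτ' x)).trans rfl

theorem isTermFunction_const {A : Set K} {α : Type*} {c : K} (hc : c ∈ A) :
    O.IsTermFunction A (fun _ : α → K => c) :=
  ⟨FirstOrder.Language.Term.var (Sum.inl ⟨c, hc⟩), fun _ => rfl⟩

theorem IsTermFunction.mono {A A' : Set K} (hA : A ⊆ A') {α : Type*} {h : (α → K) → K}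
    (H : O.IsTermFunction A h) : O.IsTermFunction A' h := by
  obtain ⟨τ, hτ⟩ := H
  refine ⟨τ.relabel (Sum.map (Set.inclusion hA) id), fun x => ?_⟩
  rw [hτ, FirstOrder.Language.Term.realize_relabel]
  congr 1
  ext i
  rcases i with i | i <;> rfl

theorem isTermFunction_aeval {k : Subfield K} {r : ℕ} {α : Type*} {θ : Fin r → (α → K) → K}
    (hθ : ∀ i, O.IsTermFunction (k : Set K) (θ i)) (p : MvPolynomial (Fin r) k) :
    O.IsTermFunction (k : Set K) (fun x => MvPolynomial.aeval (fun i => θ i x) p) := by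
  induction p using MvPolynomial.induction_on with
  | C c =>
    simp only [MvPolynomial.aeval_C]
    exact isTermFunction_const c.2
  | add p q hp hq => simpa only [map_add] using hp.add hq
  | mul_X p i hp =>
    simp only [_root_.map_mul, MvPolynomial.aeval_X]
    exact hp.mul (hθ i)

theorem IsTermFunction.definable_zero {A : Set K} {α : Type*} {h : (α → K) → K}
    (H : O.IsTermFunction A h) : A.Definable O.lang {x | h x = 0} := by
  obtain ⟨τ, hτ⟩ := H
  rw [Set.definable_iff_exists_formula_sum]
  refine ⟨τ.equal (FirstOrder.Language.Term.func (OpFunctions.zero : OpFunctions 𝔽 n 𝒟 0) ![]), ?_⟩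
  ext x
  rw [Set.mem_ofPred_eq, Set.mem_ofPred_eq, FirstOrder.Language.Formula.realize_equal, hτ]
  rfl

/-- Dependence is witnessed by a definable set. -/
theorem exists_definable_of_not_indep (H : O.Standing κ) {m : ℕ} {a : Fin m → K} {B Z : Set K}
    (hB : #B < κ) (h : ¬ O.Indep (Set.range a) B Z) :
    ∃ X : Set (Fin m → K), (O.gen (Z ∪ B) : Set K).Definable O.lang X ∧ a ∈ X ∧
      ∀ x, O.SameType B x a → x ∈ X → ¬ O.Indep (Set.range x) B Z := by
  obtain ⟨r, t, ht, hi, hd⟩ := exists_dependent_of_not_indep h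
  have h1 : ∀ i, ∃ τ : O.lang.Term (B ⊕ Fin m), t i = τ.realize (Sum.elim (↑) a) := by
    intro i
    obtain ⟨τ, hτ⟩ := FirstOrder.Language.Substructure.mem_closure_iff_exists_term.1 (ht i)
    have h2 : ∀ v : (Set.range a ∪ B : Set K), ∃ w : B ⊕ Fin m,
        (Sum.elim (↑) a w : K) = v := by
      rintro ⟨v, ⟨j, rfl⟩ | hv⟩
      · exact ⟨Sum.inr j, rfl⟩
      · exact ⟨Sum.inl ⟨v, hv⟩, rfl⟩
    choose w hw using h2
    refine ⟨τ.relabel w, ?_⟩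
    rw [FirstOrder.Language.Term.realize_relabel, ← hτ]
    congr 1
    ext v
    exact (hw v).symm
  choose τ hτ using h1
  let θ : Fin r → (Fin m → K) → K := fun i x => (τ i).realize (Sum.elim (↑) x)
  rw [algebraicIndependent_iff] at hd
  push Not at hd
  obtain ⟨p, hp, hp0⟩ := hd
  have hθ : ∀ i, O.IsTermFunction (O.gen (Z ∪ B) : Set K) (θ i) := fun i =>
    IsTermFunction.mono (A := B) (Set.subset_union_right.trans (O.subset_gen _))
      ⟨τ i, fun _ => rfl⟩
  -- The witness consists of terms in `a`, so a polynomial relation among them is a condition on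
  -- `a`. For `x` of the same type over `B`, the same terms remain independent over `gen B`, and
  -- hence the relation is a genuine dependence on `Z`.
  refine ⟨{x | MvPolynomial.aeval (fun i => θ i x) p = 0},
    (isTermFunction_aeval hθ p).definable_zero, ?_, ?_⟩
  · change MvPolynomial.aeval (fun i => θ i a) p = 0
    rw [← hp]
    congr 2
    ext i
    exact (hτ i).symm
  · intro x hx hxX hind
    obtain ⟨f, hf, hfa⟩ := hx.symm.exists_aut H.sat hB
    have hft : ∀ i, f (t i) = θ i x := by
      intro i
      rw [hτ i, ← FirstOrder.Language.HomClass.realize_term f]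
      congr 1
      ext j
      rcases j with j | j
      · exact hf j j.2
      · exact hfa j
    have hfB : f '' B = B := (Set.image_congr fun y hy => hf y hy).trans (Set.image_id' B)
    have h3 : AlgebraicIndependent (O.gen B) (fun i => θ i x) := by
      have := (algebraicIndependent_aut_iff H.assoc f).2 hi
      rw [hfB] at this
      simpa only [hft] using this
    have h4 : ∀ i, θ i x ∈ O.gen (Set.range x ∪ B) := by
      intro i
      rw [← hft i]
      have h5 := aut_mem_gen H.assoc f (Subfield.subset_closure (ht i))
      have h6 : f '' (Set.range a ∪ B) = Set.range x ∪ B := by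
        rw [Set.image_union, hfB, ← Set.range_comp]
        congr 2
        ext j
        exact hfa j
      rwa [h6] at h5
    have h7 := hind.algebraicIndependent h4 h3
    exact hp0 (h7.eq_zero_of_aeval_eq_zero p hxX)

end Dependence

end FieldOperators

namespace FieldOperators

variable {K : Type u} [Field K] {𝔽 : Subfield K} {n : ℕ} {𝒟 : Type v}
  [CommRing 𝒟] [Algebra 𝔽 𝒟] {e : Module.Basis (Fin (n + 1)) 𝔽 𝒟} {O : FieldOperators 𝔽 e}
  {κ : Cardinal.{u}}

/-! ### Existence of Morley sequences. -/

section Morley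

/-- A sequence of realizations of iterated averages is indiscernible. -/
theorem indiscernible_of_realizesAverage {U : Ultrafilter ℕ} {m : ℕ} {a s : ℕ → Fin m → K}
    {A : Set K} (ha : ∀ i, Set.range (a i) ⊆ A)
    (hs : ∀ i, O.RealizesAverage U a (A ∪ ⋃ j < i, Set.range (s j)) (s i)) (r : ℕ) :
    ∀ (t : Fin r → ℕ), StrictMono t → ∀ (X : Set (Fin r × Fin m → K)), A.Definable O.lang X →
      ((fun q : Fin r × Fin m => s q.1 q.2) ∈ X ↔ (fun q => s (t q.1) q.2) ∈ X) := by
  induction r with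
  | zero =>
    intro t _ X _
    rw [Subsingleton.elim (fun q : Fin 0 × Fin m => s q.1 q.2) (fun q => s (t q.1) q.2)]
  | succ r ih =>
    intro t ht X hX
    let glue : (Fin r × Fin m → K) → (Fin m → K) → Fin (r + 1) × Fin m → K := fun y z q =>
      Fin.lastCases (motive := fun _ => K) (z q.2) (fun i => y (i, q.2)) q.1
    have hglue : ∀ t : Fin (r + 1) → ℕ, (fun q : Fin (r + 1) × Fin m => s (t q.1) q.2) =
        glue (fun q => s (t q.1.castSucc) q.2) (s (t (Fin.last r))) := by
      intro t
      ext ⟨i, j⟩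
      refine Fin.lastCases ?_ (fun i => ?_) i <;> simp [glue]
    -- The last entry realizes the average over all earlier ones, so it may be replaced by
    -- `U`-almost every `a i`. These lie in `A`, which leaves a statement about `r` entries.
    have hsec : ∀ t : Fin (r + 1) → ℕ, StrictMono t →
        ((fun q : Fin (r + 1) × Fin m => s (t q.1) q.2) ∈ X ↔
          ∀ᶠ i in (U : Filter ℕ), glue (fun q => s (t q.1.castSucc) q.2) (a i) ∈ X) := by
      intro t ht
      rw [hglue]
      refine hs (t (Fin.last r)) {z | glue (fun q => s (t q.1.castSucc) q.2) z ∈ X} ?_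
      have hmem : ∀ q : Fin r × Fin m, s (t q.1.castSucc) q.2 ∈
          A ∪ ⋃ j < t (Fin.last r), Set.range (s j) := fun q =>
        Or.inr (Set.mem_biUnion (ht (Fin.castSucc_lt_last q.1)) ⟨q.2, rfl⟩)
      refine definable_subst (α := Fin m) (A' := A ∪ ⋃ j < t (Fin.last r), Set.range (s j))
        Set.subset_union_left hX (fun q =>
          Fin.lastCases (motive := fun _ => Fin m ⊕ (A ∪ ⋃ j < t (Fin.last r), Set.range (s j) :
            Set K)) (Sum.inl q.2) (fun i => Sum.inr ⟨_, hmem (i, q.2)⟩) q.1) ?_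
      rintro z ⟨i, j⟩
      refine Fin.lastCases ?_ (fun i => ?_) i <;> simp [glue]
    have hval : StrictMono (fun i : Fin (r + 1) => (i : ℕ)) := fun _ _ h => h
    rw [hsec t ht, hsec (fun i => (i : ℕ)) hval]
    refine Filter.eventually_congr (Filter.Eventually.of_forall fun i => ?_)
    refine ih (fun j => t j.castSucc) (fun _ _ h => ht (Fin.castSucc_lt_castSucc_iff.2 h))
      {y | glue y (a i) ∈ X} ?_
    refine definable_subst (α := Fin r × Fin m) subset_rfl hX (fun q =>
      Fin.lastCases (motive := fun _ => (Fin r × Fin m) ⊕ A)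
        (Sum.inr ⟨_, ha i ⟨q.2, rfl⟩⟩) (fun i => Sum.inl (i, q.2)) q.1) ?_
    rintro z ⟨i, j⟩
    refine Fin.lastCases ?_ (fun i => ?_) i <;> simp [glue]

theorem exists_independent_sequence (H : O.Standing κ) {B : Set K} (hB : #B < κ) {m : ℕ}
    (a : Fin m → K) : ∃ s : ℕ → Fin m → K, ∀ i, O.SameType B (s i) a ∧
      O.Indep (Set.range (s i)) B (B ∪ ⋃ j < i, Set.range (s j)) := by
  obtain ⟨s, hs⟩ := exists_sequence H.sat
    (fun T x => O.SameType B x a ∧ O.Indep (Set.range x) B T) (fun T hT => by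
      obtain ⟨x, hx, hi⟩ := H.simple.extension m a B (B ∪ T) Set.subset_union_left
        (card_union_lt H.sat hB hT)
      exact ⟨x, hx, hi.subset_right H.types Set.subset_union_right⟩) hB
  exact ⟨s, hs⟩

theorem finite_subset_iUnion_lt {M : Type*} {m : ℕ} (a : ℕ → Fin m → M) {Z : Set M}
    (hZ : Z.Finite) (h : Z ⊆ ⋃ i, Set.range (a i)) : ∃ N, Z ⊆ ⋃ j < N, Set.range (a j) := by
  induction Z, hZ using Set.Finite.induction_on with
  | empty => exact ⟨0, Set.empty_subset _⟩
  | @insert x S _ _ ih =>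
    obtain ⟨N, hN⟩ := ih ((Set.subset_insert _ _).trans h)
    obtain ⟨i, hi⟩ := Set.mem_iUnion.1 (h (Set.mem_insert x S))
    refine ⟨max N (i + 1), Set.insert_subset ?_ (hN.trans ?_)⟩
    · exact Set.mem_biUnion (show i < max N (i + 1) by omega) hi
    · exact Set.biUnion_subset_biUnion_left fun j (hj : j < N) => lt_of_lt_of_le hj (le_max_left _ _)

/-- Averages of an independent sequence are independent of it. -/
theorem indep_of_realizesAverage (H : O.Standing κ) {B : Set K} (hB : #B < κ) {m : ℕ}
    {a : ℕ → Fin m → K} {c : Fin m → K} (hac : ∀ i, O.SameType B (a i) c)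
    (hai : ∀ i, O.Indep (Set.range (a i)) B (B ∪ ⋃ j < i, Set.range (a j)))
    {W : Set K} (hW : O.Indep W B (B ∪ ⋃ i, Set.range (a i))) {x : Fin m → K}
    (hxc : O.SameType B x c)
    (hx : O.RealizesAverage (Filter.hyperfilter ℕ) a
      (O.algIn ((B ∪ ⋃ i, Set.range (a i)) ∪ W)) x) :
    O.Indep (Set.range x) B ((B ∪ ⋃ i, Set.range (a i)) ∪ W) := by
  refine Indep.symm (indep_of_forall_finite H.types fun Z hZ hZf => ?_)
  by_contra hn
  have hn' : ¬ O.Indep (Set.range x) B Z := fun h => hn h.symm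
  obtain ⟨X, hX, hxX, hXn⟩ := exists_definable_of_not_indep H hB hn'
  have hsub : (O.gen (Z ∪ B) : Set K) ⊆ O.algIn ((B ∪ ⋃ i, Set.range (a i)) ∪ W) :=
    (O.gen_subset_algIn _).trans (O.algIn_mono (Set.union_subset hZ
      (Set.subset_union_left.trans Set.subset_union_left)))
  have hev := (hx X (hX.mono hsub)).1 hxX
  obtain ⟨N, hN⟩ := finite_subset_iUnion_lt a
    (hZf.subset (Set.inter_subset_left (t := ⋃ i, Set.range (a i)))) Set.inter_subset_right
  -- The ultrafilter is nonprincipal, so some `a i` satisfying the dependence comes after every `a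
  -- j` that meets `Z`. It is independent of those, and of `W` over them, a contradiction.
  have hge : ∀ᶠ i in (Filter.hyperfilter ℕ : Filter ℕ), N ≤ i :=
    Nat.hyperfilter_le_atTop (Filter.eventually_ge_atTop N)
  obtain ⟨i, hiX, hi⟩ := (hev.and hge).exists
  refine hXn (a i) ((hac i).trans hxc.symm) hiX ?_
  have h1 : O.Indep (Set.range (a i)) B (B ∪ ⋃ j < N, Set.range (a j)) :=
    (hai i).subset_right H.types (Set.union_subset_union_right _
      (Set.biUnion_subset_biUnion_left fun j (hj : j < N) => lt_of_lt_of_le hj hi))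
  have h2 : O.Indep (Set.range (a i)) (B ∪ (B ∪ ⋃ j < N, Set.range (a j))) W := by
    refine Indep.symm (hW.over H.assoc H.types Set.subset_union_left ?_ ?_)
    · refine Set.union_subset Set.subset_union_left (Set.union_subset_union_right _ ?_)
      exact Set.iUnion_subset fun j => Set.iUnion_subset fun _ =>
        Set.subset_iUnion (fun i => Set.range (a i)) j
    · exact (Set.subset_iUnion (fun i => Set.range (a i)) i).trans Set.subset_union_right
  refine (h1.trans h2).subset_right H.types fun z hz => ?_
  rcases hZ hz with (h | h) | h
  · exact Or.inl (Or.inl h)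
  · exact Or.inl (Or.inr (hN ⟨hz, h⟩))
  · exact Or.inr h

/-- An independent sequence need not be indiscernible, but successive realizations of its average
are. They are also independent, since a dependence would be definable and so would already hold of
some term of the original sequence. -/
theorem exists_isMorleySequence (H : O.Standing κ) {B : Set K} (hB : #B < κ) {m : ℕ}
    (c : Fin m → K) : ∃ s, O.IsMorleySequence B c s := by
  obtain ⟨a, ha⟩ := exists_independent_sequence H hB c
  set A : Set K := B ∪ ⋃ i, Set.range (a i) with hA
  have hAcard : #A < κ := card_union_lt H.sat hB
    (card_lt_of_countable H.sat (Set.countable_iUnion fun i => (Set.finite_range _).countable))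
  obtain ⟨s, hs⟩ := exists_sequence H.sat
    (fun T x => O.RealizesAverage (Filter.hyperfilter ℕ) a (O.algIn T) x)
    (fun T hT => exists_realizesAverage H.sat _ a (card_algIn_lt H.sat hT)) hAcard
  have hBA : B ⊆ A := Set.subset_union_left
  have hreal : ∀ i, O.SameType B (s i) c := by
    intro i
    rw [sameType_iff_definable]
    intro X hX
    rw [hs i X (hX.mono (hBA.trans (Set.subset_union_left.trans (O.subset_algIn _))))]
    have : ∀ j, a j ∈ X ↔ c ∈ X := fun j => sameType_iff_definable.1 (ha j).1 X hX
    simp [this]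
  have hind : ∀ i, O.Indep (⋃ j < i, Set.range (s j)) B A →
      O.Indep (Set.range (s i)) B (A ∪ ⋃ j < i, Set.range (s j)) := fun i hi =>
    indep_of_realizesAverage H hB (fun j => (ha j).1) (fun j => (ha j).2) hi (hreal i) (hs i)
  -- The earlier terms play the part of `W` in `indep_of_realizesAverage`, so their independence
  -- from `A` is carried along by induction.
  have hP : ∀ i, O.Indep (⋃ j < i, Set.range (s j)) B A := by
    intro i
    induction i with
    | zero => exact (indep_of_subset_algIn H.types (by simp)).symm
    | succ i ih =>
      rw [Set.biUnion_lt_succ]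
      exact ih.union_left ((hind i ih).over H.assoc H.types Set.subset_union_left
        (Set.union_subset_union_left _ hBA) Set.subset_union_left)
  refine ⟨s, hreal, fun i => (hind i (hP i)).subset_right H.types Set.subset_union_right, ?_⟩
  intro r t ht
  rw [sameType_iff_definable]
  intro X hX
  exact indiscernible_of_realizesAverage
    (fun i => (Set.subset_iUnion (fun i => Set.range (a i)) i).trans Set.subset_union_right)
    (fun i => (hs i).mono (O.subset_algIn _)) r t ht X (hX.mono hBA)

end Morley

end FieldOperators

namespace FieldOperators

variable {K : Type u} [Field K] {𝔽 : Subfield K} {n : ℕ} {𝒟 : Type v}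
  [CommRing 𝒟] [Algebra 𝔽 𝒟] {e : Module.Basis (Fin (n + 1)) 𝔽 𝒟} {O : FieldOperators 𝔽 e}
  {κ : Cardinal.{u}}

/-! ### Bounded automorphisms and pairwise independence. -/

section Bounded

theorem mem_algIn_empty_of_indep_self {x : K} (h : O.Indep {x} ∅ {x}) : x ∈ O.algIn ∅ := by
  rw [mem_algIn]
  by_contra hx
  have h1 : AlgebraicIndependent (O.gen ∅) ![x] := by
    rw [algebraicIndependent_unique_type_iff]
    exact hx
  have hmem : x ∈ O.gen ({x} ∪ ∅) := O.subset_gen _ (by simp)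
  have h2 := h.algebraicIndependent (t := ![x]) (fun i => by simpa using hmem) h1
  rw [algebraicIndependent_unique_type_iff] at h2
  exact h2 (isAlgebraic_algebraMap (⟨x, hmem⟩ : O.gen ({x} ∪ ∅)))

/-- Translating the generic 0 by `x` makes `x` independent of itself. This disposes of the
degenerate case in which a factor of the product vanishes. -/
theorem Generic.mem_algIn_empty_of_zero (hT : O.TypesDetermined) {D : Set K}
    (h : O.Generic 0 D) (x : K) : x ∈ O.algIn ∅ := by
  have h1 := h x (indep_of_subset_algIn hT (by simpa using zero_mem_algIn)).symm
  rw [add_zero] at h1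
  exact mem_algIn_empty_of_indep_self (h1.subset_right hT Set.subset_union_right)

variable {g : K}

/-- For independent generics `a` and `b` and a bounded automorphism `τ`, the pairs `(a, τ a)` and
`(b, τ b)` are independent over the part of `cl D` that is algebraic over them. -/
theorem indep_pair_of_boundedOver (H : O.Standing κ) (hM : O.MorleyBase κ) (hg : O.Generic g ∅)
    {τ : K ≃[O.lang] K} {D : Set K} (hD : D.Finite) (hτ : O.BoundedOver κ g τ D) {a b : K}
    (ha : O.Generic a D) (hb : O.Generic b D) (hab : O.Indep {a} D {b}) {D₀ : Set K}
    (hD₀ : D₀ = O.cl κ g D ∩ O.algIn (D ∪ {a, b, τ a, τ b})) :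
    O.Indep {a, τ a} D₀ {b, τ b} := by
  have hDκ : #D < κ := card_lt_of_finite H.sat hD
  set G := O.algIn (D ∪ {a, b, τ a, τ b}) with hG
  have hGκ : #G < κ := card_algIn_lt H.sat (card_lt_of_finite H.sat (hD.union (by simp)))
  set E := O.algIn (D₀ ∪ {a, τ a}) with hE
  have hD₀G : D₀ ⊆ G := hD₀.subset.trans Set.inter_subset_right
  have hD₀E : D₀ ⊆ E := subset_algIn_union_left _ _
  have hDD₀ : D ⊆ D₀ := by
    rw [hD₀]
    exact Set.subset_inter (subset_cl H D) (subset_algIn_union_left _ _)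
  have hDE : D ⊆ E := hDD₀.trans hD₀E
  have hEG : E ⊆ G := by
    refine O.algIn_subset_algIn H.types (Set.union_subset hD₀G ?_)
    rintro x (rfl | rfl)
    · exact mem_algIn_of_mem (by simp)
    · exact mem_algIn_of_mem (by simp)
  have hEκ : #E < κ := card_lt_of_subset hEG hGκ
  -- Boundedness at `a` enters here: `τ a` costs nothing beyond `a` as far as the closure is
  -- concerned.
  have hEcl : E ⊆ O.cl κ g (D ∪ {a}) := by
    refine algIn_subset_cl H hg (Set.union_subset ?_ ?_)
    · exact (hD₀.subset.trans Set.inter_subset_left).trans (cl_mono Set.subset_union_left)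
    · rintro x (rfl | rfl)
      · exact subset_cl H _ (by simp)
      · exact hτ a ha
  have hb₀ : O.Generic b ∅ := hb.empty H hDκ
  have hbE : O.Indep {b} ∅ E :=
    (indep_union_of_subset_cl H hg subset_rfl (card_lt_of_finite H.sat (hD.union (by simp))) hEcl
      hb₀ (indep_empty_union (hb.indep_empty H.types) hab.symm)).subset_right H.types
      Set.subset_union_right
  obtain ⟨s, hs⟩ := exists_isMorleySequence H hEκ ![b, τ b]
  -- Both facts hold for `(b, τ b)` and are transported by an automorphism fixing `E`, which need
  -- not commute with `τ`; so `s i 1` need not be `τ (s i 0)`.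
  have hsi : ∀ i, O.Indep {s i 0} ∅ E ∧ s i 1 ∈ O.cl κ g (D ∪ {s i 0}) := by
    intro i
    obtain ⟨f, hf, hfs⟩ := (hs.realizes i).symm.exists_aut H.sat hEκ
    have h0 : f b = s i 0 := hfs 0
    have h1 : f (τ b) = s i 1 := hfs 1
    have hfE : ∀ S ⊆ E, f '' S = S := fun S hS =>
      (Set.image_congr fun y hy => hf y (hS hy)).trans (Set.image_id' S)
    constructor
    · have := hbE.map H.assoc f
      rwa [Set.image_singleton, Set.image_empty, hfE E subset_rfl, h0] at this
    · have := cl_aut H hg f (hτ b hb)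
      rwa [Set.image_union, Set.image_singleton, hfE D hDE, h0, h1] at this
  -- Only the first coordinates are independent of `E` over ∅; the second ones are controlled
  -- through cl alone.
  have hY : ∀ r, O.Indep (⋃ j < r, {s j 0}) ∅ E := by
    intro r
    induction r with
    | zero => exact (indep_of_subset_algIn H.types (by simp)).symm
    | succ r ih =>
      rw [Set.biUnion_lt_succ]
      refine ih.union_left ?_
      rw [Set.empty_union]
      have h1 := indep_empty_union (hsi r).1
        ((hs.indep r).subset_left H.types (Set.singleton_subset_iff.2 ⟨0, rfl⟩))
      refine h1.over H.assoc H.types (Set.empty_subset _) ?_ Set.subset_union_left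
      refine Set.subset_union_of_subset_right (Set.iUnion₂_mono fun j _ => ?_) _
      exact Set.singleton_subset_iff.2 ⟨0, rfl⟩
  -- The core of the argument: such an `x` is in the closure of `D` and finitely many `s j 0`, and
  -- is independent of these over `D` because it lies in `E`.
  have hX : E ∩ O.algIn (⋃ i, Set.range (s i)) ⊆ D₀ := by
    rintro x ⟨hxE, hx⟩
    rw [hD₀]
    refine ⟨?_, hEG hxE⟩
    obtain ⟨Z, hZ, hZf, hxZ⟩ := exists_finite_of_mem_algIn H.types hx
    obtain ⟨N, hN⟩ := finite_subset_iUnion_lt s hZf hZ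
    have hYf : (⋃ j < N, {s j 0}).Finite :=
      (Set.finite_lt_nat N).biUnion fun _ _ => Set.finite_singleton _
    refine mem_cl_of_indep H hg hYf hDκ (algIn_subset_cl H hg (hN.trans ?_) hxZ) ?_
    · refine Set.iUnion₂_subset fun j hj => ?_
      have hjY : s j 0 ∈ ⋃ j < N, {s j 0} := Set.mem_biUnion (show j < N from hj) rfl
      rintro _ ⟨i, rfl⟩
      fin_cases i
      · exact subset_cl H _ (Or.inr hjY)
      · exact cl_mono (Set.union_subset_union_right _ (Set.singleton_subset_iff.2 hjY)) (hsi j).2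
    · exact ((hY N).over H.assoc H.types (Set.empty_subset _) hDE
        (Set.singleton_subset_iff.2 hxE)).symm
  have h1 := hM E (O.algIn_algIn H.types _).symm hEκ 2 _ s hs
  have h2 : O.Indep (Set.range ![b, τ b]) D₀ {a, τ a} :=
    h1.over H.assoc H.types hX hD₀E (Set.subset_union_right.trans (O.subset_algIn _))
  rw [Matrix.range_cons, Matrix.range_cons, Matrix.range_empty, Set.union_empty,
    Set.singleton_union] at h2
  exact h2.symm

/-- Pairwise independence for three pairwise independent generics, each of which is algebraic over
the other two, together with its image. -/
theorem pairwiseIndep_of_boundedOver (H : O.Standing κ) (hM : O.MorleyBase κ)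
    (hg : O.Generic g ∅) {τ : K ≃[O.lang] K} {D : Set K} (hD : D.Finite)
    (hτ : O.BoundedOver κ g τ D) {a b c : K} (ha : O.Generic a D) (hb : O.Generic b D)
    (hc : O.Generic c D) (hab : O.Indep {a} D {b}) (hac : O.Indep {a} D {c})
    (hbc : O.Indep {b} D {c})
    (hcm : {c, τ c} ⊆ O.algIn (D ∪ {a, b, τ a, τ b}))
    (hbm : {b, τ b} ⊆ O.algIn (D ∪ {a, c, τ a, τ c}))
    (ham : {a, τ a} ⊆ O.algIn (D ∪ {b, c, τ b, τ c})) {D₀ : Set K}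
    (hD₀ : D₀ = O.cl κ g D ∩ O.algIn (D ∪ {a, b, τ a, τ b})) :
    O.PairwiseIndep D₀ {a, τ a} {b, τ b} {c, τ c} := by
  have hle : ∀ {x y z w : K} {A : Set K}, x ∈ O.algIn (D ∪ A) → y ∈ O.algIn (D ∪ A) →
      z ∈ O.algIn (D ∪ A) → w ∈ O.algIn (D ∪ A) →
      O.algIn (D ∪ {x, y, z, w}) ⊆ O.algIn (D ∪ A) := by
    intro x y z w A hx hy hz hw
    refine O.algIn_subset_algIn H.types (Set.union_subset (subset_algIn_union_left _ _) ?_)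
    rintro _ (rfl | rfl | rfl | rfl) <;> assumption
  -- Interalgebraicity makes the definition of `D₀` symmetric in the three pairs.
  have h1 : O.algIn (D ∪ {a, b, τ a, τ b}) = O.algIn (D ∪ {a, c, τ a, τ c}) :=
    (hle (mem_algIn_of_mem (by simp)) (hbm (by simp)) (mem_algIn_of_mem (by simp))
      (hbm (by simp))).antisymm
    (hle (mem_algIn_of_mem (by simp)) (hcm (by simp)) (mem_algIn_of_mem (by simp))
      (hcm (by simp)))
  have h2 : O.algIn (D ∪ {a, b, τ a, τ b}) = O.algIn (D ∪ {b, c, τ b, τ c}) :=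
    (hle (ham (by simp)) (mem_algIn_of_mem (by simp)) (ham (by simp))
      (mem_algIn_of_mem (by simp))).antisymm
    (hle (mem_algIn_of_mem (by simp)) (hcm (by simp)) (mem_algIn_of_mem (by simp))
      (hcm (by simp)))
  exact ⟨indep_pair_of_boundedOver H hM hg hD hτ ha hb hab hD₀,
    indep_pair_of_boundedOver H hM hg hD hτ ha hc hac (h1 ▸ hD₀),
    indep_pair_of_boundedOver H hM hg hD hτ hb hc hbc (h2 ▸ hD₀)⟩

theorem Generic.mul_of_indep (H : O.Standing κ) {D : Set K} (hD : #D < κ) {a b : K}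
    (hb : O.Generic b D) (hab : O.Indep {a} D {b}) (ha0 : a ≠ 0) :
    O.Generic (a * b) D ∧ O.Indep {a} D {a * b} := by
  have h1 := indep_empty_union (hb.indep_empty H.types) hab.symm
  obtain ⟨h2, h3⟩ := (hb.empty H hD).mul H h1
    (card_union_lt H.sat hD (card_lt_of_finite H.sat (Set.finite_singleton a))) (Or.inr rfl) ha0
  exact ⟨generic_of_indep_empty H h2 (h3.subset_right H.types Set.subset_union_left),
    (h3.over H.assoc H.types (Set.empty_subset _) Set.subset_union_left
      Set.subset_union_right).symm⟩

theorem Generic.add_of_indep (H : O.Standing κ) {D : Set K} (hD : #D < κ) {a b : K}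
    (hb : O.Generic b D) (hab : O.Indep {a} D {b}) :
    O.Generic (a + b) D ∧ O.Indep {a} D {a + b} := by
  have h1 := indep_empty_union (hb.indep_empty H.types) hab.symm
  have hb₀ := hb.empty H hD
  have h2 := hb₀.add H (h1.subset_right H.types Set.subset_union_right)
  have h3 := hb₀.add_indep H h1 (mem_algIn_of_mem (Or.inr rfl))
  exact ⟨generic_of_indep_empty H h2 (h3.subset_right H.types Set.subset_union_left),
    (h3.over H.assoc H.types (Set.empty_subset _) Set.subset_union_left
      Set.subset_union_right).symm⟩

theorem pairwiseIndep_mul (H : O.Standing κ) (hM : O.MorleyBase κ)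
    (hg : O.Generic g ∅) {τ : K ≃[O.lang] K} {D : Set K} (hD : D.Finite)
    (hτ : O.BoundedOver κ g τ D) {a b : K} (ha : O.Generic a D) (hb : O.Generic b D)
    (hab : O.Indep {a} D {b}) {D₀ : Set K}
    (hD₀ : D₀ = O.cl κ g D ∩ O.algIn (D ∪ {a, b, τ a, τ b})) :
    O.PairwiseIndep D₀ {a, τ a} {b, τ b} {a * b, τ (a * b)} := by
  by_cases h0 : a = 0 ∨ b = 0
  · have hall : ∀ x : K, x ∈ O.algIn ∅ := by
      rcases h0 with rfl | rfl
      · exact ha.mem_algIn_empty_of_zero H.types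
      · exact hb.mem_algIn_empty_of_zero H.types
    have hind : ∀ A B : Set K, O.Indep A D₀ B := fun A B =>
      indep_of_subset_algIn H.types fun x _ => O.algIn_mono (Set.empty_subset _) (hall x)
    exact ⟨hind _ _, hind _ _, hind _ _⟩
  obtain ⟨ha0, hb0⟩ := not_or.1 h0
  have hτ0 : ∀ {x : K}, x ≠ 0 → τ x ≠ 0 := fun hx => (map_ne_zero (autRing τ)).2 hx
  have hDκ : #D < κ := card_lt_of_finite H.sat hD
  obtain ⟨hc, hac⟩ := hb.mul_of_indep H hDκ hab ha0
  have hbc : O.Indep {b} D {a * b} := mul_comm b a ▸ (ha.mul_of_indep H hDκ hab.symm hb0).2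
  have hτm : τ (a * b) = τ a * τ b := aut_mul τ a b
  have hmem : ∀ {A : Set K} {x y z : K}, x ∈ A → z ∈ A → x ≠ 0 → z = x * y → y ∈ O.algIn A := by
    intro A x y z hx hz hx0 h
    rw [show y = x⁻¹ * z by rw [h]; field_simp]
    exact mul_mem_algIn (inv_mem_algIn (mem_algIn_of_mem hx)) (mem_algIn_of_mem hz)
  refine pairwiseIndep_of_boundedOver H hM hg hD hτ ha hb hc hab hac hbc ?_ ?_ ?_ hD₀
  · rintro x (rfl | rfl)
    · exact mul_mem_algIn (mem_algIn_of_mem (by simp)) (mem_algIn_of_mem (by simp))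
    · rw [hτm]
      exact mul_mem_algIn (mem_algIn_of_mem (by simp)) (mem_algIn_of_mem (by simp))
  · rintro x (rfl | rfl)
    · exact hmem (x := a) (z := a * x) (by simp) (by simp) ha0 rfl
    · exact hmem (x := τ a) (z := τ (a * b)) (by simp) (by simp) (hτ0 ha0) hτm
  · rintro x (rfl | rfl)
    · exact hmem (x := b) (z := x * b) (by simp) (by simp) hb0 (mul_comm _ _)
    · exact hmem (x := τ b) (z := τ (a * b)) (by simp) (by simp) (hτ0 hb0)
        (hτm.trans (mul_comm _ _))

theorem pairwiseIndep_add (H : O.Standing κ) (hM : O.MorleyBase κ)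
    (hg : O.Generic g ∅) {τ : K ≃[O.lang] K} {D : Set K} (hD : D.Finite)
    (hτ : O.BoundedOver κ g τ D) {a b : K} (ha : O.Generic a D) (hb : O.Generic b D)
    (hab : O.Indep {a} D {b}) {D₀ : Set K}
    (hD₀ : D₀ = O.cl κ g D ∩ O.algIn (D ∪ {a, b, τ a, τ b})) :
    O.PairwiseIndep D₀ {a, τ a} {b, τ b} {a + b, τ (a + b)} := by
  have hDκ : #D < κ := card_lt_of_finite H.sat hD
  obtain ⟨hc, hac⟩ := hb.add_of_indep H hDκ hab
  have hbc : O.Indep {b} D {a + b} := add_comm b a ▸ (ha.add_of_indep H hDκ hab.symm).2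
  have hτa : τ (a + b) = τ a + τ b := aut_add τ a b
  have hmem : ∀ {A : Set K} {x y z : K}, x ∈ A → z ∈ A → z = x + y → y ∈ O.algIn A := by
    intro A x y z hx hz h
    rw [show y = z - x by rw [h]; ring]
    exact sub_mem_algIn (mem_algIn_of_mem hz) (mem_algIn_of_mem hx)
  refine pairwiseIndep_of_boundedOver H hM hg hD hτ ha hb hc hab hac hbc ?_ ?_ ?_ hD₀
  · rintro x (rfl | rfl)
    · exact add_mem_algIn (mem_algIn_of_mem (by simp)) (mem_algIn_of_mem (by simp))
    · rw [hτa]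
      exact add_mem_algIn (mem_algIn_of_mem (by simp)) (mem_algIn_of_mem (by simp))
  · rintro x (rfl | rfl)
    · exact hmem (x := a) (z := a + x) (by simp) (by simp) rfl
    · exact hmem (x := τ a) (z := τ (a + b)) (by simp) (by simp) hτa
  · rintro x (rfl | rfl)
    · exact hmem (x := b) (z := x + b) (by simp) (by simp) (add_comm _ _)
    · exact hmem (x := τ b) (z := τ (a + b)) (by simp) (by simp) (hτa.trans (add_comm _ _))

end Bounded

end FieldOperators

theorem mainTheorem6 {K : Type u} [Field K] (𝔽 : Subfield K) {n : ℕ} {𝒟 : Type v}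
    [CommRing 𝒟] [Algebra 𝔽 𝒟] (e : Module.Basis (Fin (n + 1)) 𝔽 𝒟)
    (O : FieldOperators 𝔽 e) (κ : Cardinal.{u})
    (hResidue : O.ResidueFieldsEqBase)
    (hEndo : O.AssociatedBijective)
    (hSat : O.SufficientlySaturated κ)
    (hTypes : O.TypesDetermined)
    (hSimple : O.IndepSimple κ)
    (hMorley : O.MorleyBase κ)
    (g : K) (hg : O.Generic g ∅)
    (τ : K ≃[O.lang] K) (D : Set K) (hD : D.Finite) (hτ : O.BoundedOver κ g τ D)
    (a b : K) (ha : O.Generic a D) (hb : O.Generic b D) (hab : O.Indep {a} D {b})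
    (D₀ : Set K) (hD₀ : D₀ = O.cl κ g D ∩ O.algIn (D ∪ {a, b, τ a, τ b})) :
    O.PairwiseIndep D₀ {a, τ a} {b, τ b} {a * b, τ (a * b)} ∧
      O.PairwiseIndep D₀ {a, τ a} {b, τ b} {a + b, τ (a + b)} := by
  have H : O.Standing κ := ⟨hEndo, hSat, hTypes, hSimple⟩
  exact ⟨FieldOperators.pairwiseIndep_mul H hMorley hg hD hτ ha hb hab hD₀,
    FieldOperators.pairwiseIndep_add H hMorley hg hD hτ ha hb hab hD₀⟩
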